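/- \textbf{Setting.} Let $\mathcal H_S,\mathcal H_A$ be complex separable Hilbert spaces, $\mathcal L(\mathcal H)$ the bounded operators and $\mathcal T(\mathcal H)$ the trace-class operators on $\mathcal H$. An \emph{operation} is a completely positive, trace non-increasing linear map $\Phi:\mathcal T(\mathcal H)\to\mathcal T(\mathcal K)$, and a \emph{channel} is a trace-preserving operation; the dual $\Phi^*:\mathcal L(\mathcal K)\to\mathcal L(\mathcal H)$ is determined by $\mathrm{tr}[\Phi^*(A)T]=\mathrm{tr}[A\,\Phi(T)]$. A \emph{state} is a positive trace-class operator of unit trace. A (discrete) \emph{observable} $\mathsf E$ with countable outcome set $\mathcal X$ is a family of positive operators $\mathsf E(x)$, $x\in\mathcal X$, with $\sum_{x}\mathsf E(x)=\mathbb 1$. An \emph{$\mathsf E$-instrument} is a family $\mathcal I=(\mathcal I_x)_{x\in\mathcal X}$ of operations on $\mathcal T(\mathcal H_S)$ such that $\mathcal I_{\mathcal X}:=\sum_x\mathcal I_x$ is a channel and $\mathcal I_x^*(\mathbb 1)=\mathsf E(x)$ for all $x$. A \emph{measurement scheme} for $\mathcal I$ is a tuple $(\mathcal H_A,\xi,\mathcal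 E,\mathsf Z)$ with $\xi$ a state on $\mathcal H_A$, $\mathcal E$ a channel on $\mathcal T(\mathcal H_S\otimes\mathcal H_A)$ and $\mathsf Z$ an observable on $\mathcal H_A$ with outcome set $\mathcal X$, such that $\mathcal I_x(T)=\mathrm{tr}_A[(\mathbb 1\otimes\mathsf Z(x))\,\mathcal E(T\otimes\xi)]$ for all $x\in\mathcal X$ and $T\in\mathcal T(\mathcal H_S)$. Let $\mathcal F(\mathcal I_{\mathcal X}^*):=\{A\in\mathcal L(\mathcal H_S):\mathcal I_{\mathcal X}^*(A)=A\}$. The instrument $\mathcal I$ \emph{does not disturb} an observable $\mathsf F$ if $\mathcal I_{\mathcal X}^*(\mathsf F(y))=\mathsf F(y)$ for all outcomes $y$; it is \emph{of the first kind} if it does not disturb $\mathsf E$; it is \emph{repeatable} if $\mathrm{tr}[\mathcal I_y(\mathcal I_x(\rho))]=\delta_{x,y}\,\mathrm{tr}[\mathcal I_x(\rho)]$ for all $x,y\in\mathcal X$ and all states $\rho$. The observable $\mathsf E$ is \emph{commutative} if its effects $\mathsf E(x)$ commute with each other, and \emph{sharp} if $\mathsf E(x)\mathsf E(y)=\delta_{x,y}\mathsf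 E(x)$ for all $x,y$; an observable commutes with an operator (or with another observable) if all its effects do. \textbf{Theorem.} Let $(\mathcal H_A,\xi,\mathcal E,\mathsf Z)$ be a measurement scheme for an $\mathsf E$-instrument $\mathcal I$ on $\mathcal H_S$. Let $N_S\in\mathcal L(\mathcal H_S)$ and $N_A\in\mathcal L(\mathcal H_A)$ be self-adjoint, and assume that $\mathcal E$ conserves $N=N_S\otimes\mathbb 1+\mathbb 1\otimes N_A$ on average, i.e. $\mathrm{tr}[N\,\mathcal E(\rho)]=\mathrm{tr}[N\rho]$ for all states $\rho$ on $\mathcal H_S\otimes\mathcal H_A$. Assume also that $\mathcal F(\mathcal I_{\mathcal X}^*)$ is a von Neumann algebra. Then: \begin{enumerate} \item[(i)] If $\mathcal I$ does not disturb an observable $\mathsf F$ (discrete, with an arbitrary countable outcome set), then $\mathsf F$ commutes with $\mathsf E$ and with $\Delta N_S:=\mathcal I_{\mathcal X}^*(N_S)-N_S$; moreover, for such $\mathsf F$, $[\mathsf F,N_S]=0$ is sufficient for $[\mathsf F,\Delta N_S]=0$. \item[(ii)] If $\mathcal I$ is of the first kind, then $\mathsf E$ is commutative and commutes with $N_S$.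 \item[(iii)] If $\mathcal I$ is repeatable, then $\mathsf E$ is sharp and commutes with $N_S$. \end{enumerate} -/

import Mathlib

namespace QMeas

open scoped ComplexOrder InnerProductSpace TensorProduct
open InnerProductSpace

noncomputable section

section TraceClass

variable {H : Type*} [NormedAddCommGroup H] [InnerProductSpace ℂ H]

/-- Trace-class (nuclear) operators: `T = ∑ₙ |fₙ⟩⟨gₙ|` with `∑ₙ ‖fₙ‖ ‖gₙ‖ < ∞`. -/
def IsTraceClass (T : H →L[ℂ] H) : Prop :=
  ∃ f g : ℕ → H, Summable (fun n => ‖f n‖ * ‖g n‖) ∧ HasSum (fun n => rankOne ℂ (f n) (g n)) T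

theorem IsTraceClass.of_hasSum {ι : Type*} {f g : ι → H} {T : H →L[ℂ] H}
    (hs : Summable (fun n => ‖f n‖ * ‖g n‖)) (hT : HasSum (fun n => rankOne ℂ (f n) (g n)) T) :
    IsTraceClass T := by
  have hc : (Function.support (fun n => ‖f n‖ * ‖g n‖)).Countable := hs.countable_support
  set s := Function.support (fun n => ‖f n‖ * ‖g n‖)
  have : Countable s := hc
  obtain ⟨e, he⟩ := exists_injective_nat s
  refine ⟨Function.extend e (fun n => f n) 0, Function.extend e (fun n => g n) 0, ?_, ?_⟩
  · rw [← he.summable_iff]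
    · refine (hs.subtype s).congr fun x => ?_
      simp only [Function.comp_apply, he.extend_apply]
    · intro x hx
      rw [Function.extend_apply' _ _ _ hx]; simp
  · rw [← he.hasSum_iff]
    · have := (hasSum_subtype_iff_of_support_subset (f := fun n => rankOne ℂ (f n) (g n))
        (s := s) (a := T) ?_).2 hT
      · refine this.congr_fun fun x => ?_
        simp only [Function.comp_apply, he.extend_apply]
      · intro x hx
        simp only [Function.mem_support, ne_eq, rankOne_eq_zero, not_or] at hx
        simp [s, hx.1, hx.2]
    · intro x hx
      rw [Function.extend_apply' _ _ _ hx]; simp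

theorem isTraceClass_rankOne (x y : H) : IsTraceClass (rankOne ℂ x y) := by
  refine IsTraceClass.of_hasSum (ι := Unit) (f := fun _ => x) (g := fun _ => y)
    (Summable.of_finite) ?_
  exact hasSum_unique (fun _ : Unit => rankOne ℂ x y)

/-- The space `𝒯(H)` of trace-class operators. -/
def TC (H : Type*) [NormedAddCommGroup H] [InnerProductSpace ℂ H] :
    Submodule ℂ (H →L[ℂ] H) where
  carrier := {T | IsTraceClass T}
  zero_mem' := by simpa using isTraceClass_rankOne (0 : H) 0
  add_mem' := by
    rintro S T ⟨f, g, hs, hS⟩ ⟨f', g', hs', hT⟩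
    refine IsTraceClass.of_hasSum (ι := ℕ ⊕ ℕ) (f := Sum.elim f f') (g := Sum.elim g g') ?_ ?_
    · exact (HasSum.sum (by exact hs.hasSum) (by exact hs'.hasSum)).summable
    · exact HasSum.sum (by exact hS) (by exact hT)
  smul_mem' := by
    rintro c T ⟨f, g, hs, hT⟩
    refine ⟨fun n => c • f n, g, ?_, ?_⟩
    · simpa [norm_smul, mul_assoc] using hs.mul_left ‖c‖
    · simpa using hT.const_smul c

theorem mul_mem_TC (A : H →L[ℂ] H) {T : H →L[ℂ] H} (hT : T ∈ TC H) : A * T ∈ TC H := by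
  obtain ⟨f, g, hs, hT⟩ := hT
  refine IsTraceClass.of_hasSum (f := fun n => A (f n)) (g := g) ?_ ?_
  · refine (hs.mul_left ‖A‖).of_nonneg_of_le (fun n => by positivity) fun n => ?_
    rw [← mul_assoc]; gcongr; exact A.le_opNorm _
  · simpa [ContinuousLinearMap.mul_def, comp_rankOne] using! hT.mul_left A

/-- The operator `A T` as an element of `𝒯(H)`. -/
def TC.lmul (A : H →L[ℂ] H) (T : TC H) : TC H := ⟨A * T, mul_mem_TC A T.2⟩

/-- `|x⟩⟨y|` as an element of `𝒯(H)`. -/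
def TC.ketbra (x y : H) : TC H := ⟨rankOne ℂ x y, isTraceClass_rankOne x y⟩

theorem sum_norm_inner_mul_le {ι : Type*} {b : ι → H} (hb : Orthonormal ℂ b) (f g : H)
    (s : Finset ι) : ∑ i ∈ s, ‖⟪b i, f⟫_ℂ * ⟪g, b i⟫_ℂ‖ ≤ ‖f‖ * ‖g‖ := by
  calc ∑ i ∈ s, ‖⟪b i, f⟫_ℂ * ⟪g, b i⟫_ℂ‖ = ∑ i ∈ s, ‖⟪b i, f⟫_ℂ‖ * ‖⟪b i, g⟫_ℂ‖ := by
        simp [norm_inner_symm g]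
    _ ≤ √(∑ i ∈ s, ‖⟪b i, f⟫_ℂ‖ ^ 2) * √(∑ i ∈ s, ‖⟪b i, g⟫_ℂ‖ ^ 2) :=
        Real.sum_mul_le_sqrt_mul_sqrt _ _ _
    _ ≤ √(‖f‖ ^ 2) * √(‖g‖ ^ 2) := by
        gcongr <;> exact hb.sum_inner_products_le _
    _ = ‖f‖ * ‖g‖ := by simp

theorem hasSum_basis {ι κ : Type*} {f g : κ → H} {T : H →L[ℂ] H}
    (hs : Summable (fun n => ‖f n‖ * ‖g n‖)) (hT : HasSum (fun n => rankOne ℂ (f n) (g n)) T)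
    (b : HilbertBasis ι ℂ H) :
    HasSum (fun i => ⟪b i, T (b i)⟫_ℂ) (∑' n, ⟪g n, f n⟫_ℂ) := by
  have hF : Summable (fun p : κ × ι => ⟪b p.2, f p.1⟫_ℂ * ⟪g p.1, b p.2⟫_ℂ) := by
    apply Summable.of_norm
    rw [summable_prod_of_nonneg (fun _ => norm_nonneg _)]
    refine ⟨fun n => summable_of_sum_le (fun _ => norm_nonneg _)
      (sum_norm_inner_mul_le b.orthonormal (f n) (g n)), ?_⟩
    refine hs.of_nonneg_of_le (fun n => tsum_nonneg fun _ => norm_nonneg _) fun n => ?_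
    exact Real.tsum_le_of_sum_le (fun _ => norm_nonneg _)
      (sum_norm_inner_mul_le b.orthonormal (f n) (g n))
  have h1 : ∀ n, HasSum (fun i => ⟪b i, f n⟫_ℂ * ⟪g n, b i⟫_ℂ) ⟪g n, f n⟫_ℂ := fun n => by
    simpa [mul_comm] using b.hasSum_inner_mul_inner (g n) (f n)
  have h2 : ∀ i, HasSum (fun n => ⟪b i, f n⟫_ℂ * ⟪g n, b i⟫_ℂ) ⟪b i, T (b i)⟫_ℂ := fun i => by
    have := (hT.mapL (ContinuousLinearMap.apply ℂ H (b i))).mapL (innerSL ℂ (b i))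
    simpa [inner_smul_right, mul_comm] using this
  have h3 := (hF.hasSum.prod_fiberwise h1).tsum_eq
  rw [h3]
  exact ((Equiv.prodComm ι κ).hasSum_iff.2 hF.hasSum).prod_fiberwise h2

variable [CompleteSpace H]

/-- The trace `∑ᵢ ⟨eᵢ, T eᵢ⟩`, with respect to a fixed Hilbert basis of `H`. -/
def trace (T : H →L[ℂ] H) : ℂ :=
  ∑' i, ⟪(exists_hilbertBasis ℂ H).choose_spec.choose i,
    T ((exists_hilbertBasis ℂ H).choose_spec.choose i)⟫_ℂ

theorem trace_eq_tsum {κ : Type*} {f g : κ → H} {T : H →L[ℂ] H}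
    (hs : Summable (fun n => ‖f n‖ * ‖g n‖)) (hT : HasSum (fun n => rankOne ℂ (f n) (g n)) T) :
    trace T = ∑' n, ⟪g n, f n⟫_ℂ :=
  (hasSum_basis hs hT _).tsum_eq

/-- On trace-class operators the trace does not depend on the basis. -/
theorem hasSum_trace {ι : Type*} (T : TC H) (b : HilbertBasis ι ℂ H) :
    HasSum (fun i => ⟪b i, (T : H →L[ℂ] H) (b i)⟫_ℂ) (trace (T : H →L[ℂ] H)) := by
  obtain ⟨f, g, hs, hT⟩ := T.2
  rw [trace_eq_tsum hs hT]
  exact hasSum_basis hs hT b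

theorem hasSum_trace_mul {κ : Type*} {f g : κ → H} {T : H →L[ℂ] H}
    (hs : Summable (fun n => ‖f n‖ * ‖g n‖)) (hT : HasSum (fun n => rankOne ℂ (f n) (g n)) T)
    (A : H →L[ℂ] H) : HasSum (fun n => ⟪g n, A (f n)⟫_ℂ) (trace (A * T)) := by
  have hs' : Summable (fun n => ‖A (f n)‖ * ‖g n‖) := by
    refine (hs.mul_left ‖A‖).of_nonneg_of_le (fun n => by positivity) fun n => ?_
    rw [← mul_assoc]; gcongr; exact A.le_opNorm _
  have hT' : HasSum (fun n => rankOne ℂ (A (f n)) (g n)) (A * T) := by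
    simpa [ContinuousLinearMap.mul_def, comp_rankOne] using! hT.mul_left A
  rw [trace_eq_tsum hs' hT']
  refine Summable.hasSum (hs'.of_norm_bounded fun n => ?_)
  rw [mul_comm]; exact norm_inner_le_norm _ _

theorem trace_mul_comm (A : H →L[ℂ] H) (T : TC H) :
    trace ((T : H →L[ℂ] H) * A) = trace (A * (T : H →L[ℂ] H)) := by
  obtain ⟨f, g, hs, hT⟩ := T.2
  rw [← (hasSum_trace_mul hs hT A).tsum_eq]
  have hs' : Summable (fun n => ‖f n‖ * ‖A.adjoint (g n)‖) := by
    refine (hs.mul_left ‖A‖).of_nonneg_of_le (fun n => by positivity) fun n => ?_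
    rw [mul_left_comm]; gcongr; simpa using A.adjoint.le_opNorm (g n)
  have hT' : HasSum (fun n => rankOne ℂ (f n) (A.adjoint (g n))) ((T : H →L[ℂ] H) * A) := by
    simpa [ContinuousLinearMap.mul_def, InnerProductSpace.rankOne_comp] using! hT.mul_right A
  rw [trace_eq_tsum hs' hT']
  simp [ContinuousLinearMap.adjoint_inner_left]

theorem trace_add (S T : TC H) :
    trace ((S : H →L[ℂ] H) + (T : H →L[ℂ] H)) = trace (S : H →L[ℂ] H) + trace (T : H →L[ℂ] H) := by
  obtain ⟨w, b, -⟩ := exists_hilbertBasis ℂ H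
  refine (hasSum_trace (S + T) b).unique ?_
  simpa [inner_add_right] using (hasSum_trace S b).add (hasSum_trace T b)

theorem trace_smul (c : ℂ) (T : TC H) : trace (c • (T : H →L[ℂ] H)) = c * trace (T : H →L[ℂ] H) := by
  obtain ⟨w, b, -⟩ := exists_hilbertBasis ℂ H
  refine (hasSum_trace (c • T) b).unique ?_
  simpa [inner_smul_right] using (hasSum_trace T b).mul_left c

/-- The linear functional `T ↦ tr[A T]` on `𝒯(H)`. -/
def traceL (A : H →L[ℂ] H) : TC H →ₗ[ℂ] ℂ where
  toFun T := trace (A * (T : H →L[ℂ] H))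
  map_add' S T := by
    simpa [TC.lmul, mul_add] using trace_add (TC.lmul A S) (TC.lmul A T)
  map_smul' c T := by simpa [TC.lmul] using trace_smul c (TC.lmul A T)

theorem traceL_ketbra (A : H →L[ℂ] H) (x y : H) : traceL A (TC.ketbra x y) = ⟪y, A x⟫_ℂ := by
  have := hasSum_trace_mul (κ := Unit) (f := fun _ => x) (g := fun _ => y) (Summable.of_finite)
    (T := rankOne ℂ x y) (hasSum_unique (fun _ : Unit => rankOne ℂ x y)) A
  simpa using! (this.unique (hasSum_fintype _))

theorem trace_nonneg {P : TC H} (hP : (P : H →L[ℂ] H).IsPositive) : 0 ≤ trace (P : H →L[ℂ] H) := by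
  obtain ⟨w, b, -⟩ := exists_hilbertBasis ℂ H
  exact (hasSum_trace P b).nonneg fun i => hP.inner_nonneg_right _

theorem traceL_nonneg {P : TC H} (hP : (P : H →L[ℂ] H).IsPositive) (A : H →L[ℂ] H) :
    0 ≤ traceL (A.adjoint * A) P := by
  have h : traceL (A.adjoint * A) P = trace (A * (P : H →L[ℂ] H) * A.adjoint) := by
    have := trace_mul_comm A.adjoint (TC.lmul A P)
    simp only [TC.lmul] at this
    rw [this]; simp [traceL, mul_assoc]
  rw [h]
  obtain ⟨w, b, -⟩ := exists_hilbertBasis ℂ H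
  have hm : A * (P : H →L[ℂ] H) * A.adjoint ∈ TC H := by
    obtain ⟨f, g, hs, hT⟩ := (TC.lmul A P).2
    refine IsTraceClass.of_hasSum (f := f) (g := fun n => A (g n)) ?_ ?_
    · refine (hs.mul_left ‖A‖).of_nonneg_of_le (fun n => by positivity) fun n => ?_
      rw [mul_left_comm]; gcongr; exact A.le_opNorm _
    · have := hT.mul_right A.adjoint
      simpa [ContinuousLinearMap.mul_def, InnerProductSpace.rankOne_comp, TC.lmul] using! this
  refine trace_nonneg (P := ⟨_, hm⟩) ?_
  simpa [mul_assoc] using! hP.conj_adjoint A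

end TraceClass

section Operations

variable {H K : Type*} [NormedAddCommGroup H] [InnerProductSpace ℂ H]
  [NormedAddCommGroup K] [InnerProductSpace ℂ K]

/-- Positivity of the operator matrix `(T i j)` on the direct sum of `n` copies of `H`. -/
def BlockPositive {n : ℕ} (T : Fin n → Fin n → (H →L[ℂ] H)) : Prop :=
  ∀ v : Fin n → H, 0 ≤ ∑ i, ∑ j, ⟪v i, T i j (v j)⟫_ℂ

/-- Complete positivity of a linear map `𝒯(H) → 𝒯(K)`. -/
def IsCompletelyPositive (Φ : TC H →ₗ[ℂ] TC K) : Prop :=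
  ∀ (n : ℕ) (T : Fin n → Fin n → TC H), BlockPositive (fun i j => (T i j : H →L[ℂ] H)) →
    BlockPositive (fun i j => (Φ (T i j) : K →L[ℂ] K))

theorem isPositive_of_inner_nonneg {T : H →L[ℂ] H} (h : ∀ x, 0 ≤ ⟪x, T x⟫_ℂ) : T.IsPositive := by
  rw [ContinuousLinearMap.isPositive_iff_complex]
  intro x
  have h3 := Complex.le_def.1 (h x)
  have h2 : ⟪T x, x⟫_ℂ = ⟪x, T x⟫_ℂ := by
    rw [← inner_conj_symm]
    exact Complex.conj_eq_iff_im.2 h3.2.symm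
  rw [h2]
  refine ⟨?_, h3.1⟩
  apply Complex.ext
  · simp
  · simpa using h3.2

theorem IsCompletelyPositive.isPositive {Φ : TC H →ₗ[ℂ] TC K} (h : IsCompletelyPositive Φ)
    {P : TC H} (hP : (P : H →L[ℂ] H).IsPositive) : (Φ P : K →L[ℂ] K).IsPositive := by
  have := h 1 (fun _ _ => P) fun v => by simpa using hP.inner_nonneg_right (v 0)
  exact isPositive_of_inner_nonneg fun x => by simpa using this (fun _ => x)

variable [CompleteSpace H] [CompleteSpace K]

/-- Operations: completely positive, trace non-increasing linear maps `𝒯(H) → 𝒯(K)`. -/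
structure Operation (H K : Type*) [NormedAddCommGroup H] [InnerProductSpace ℂ H] [CompleteSpace H]
    [NormedAddCommGroup K] [InnerProductSpace ℂ K] [CompleteSpace K] where
  toLin : TC H →ₗ[ℂ] TC K
  cp : IsCompletelyPositive toLin
  trace_le : ∀ T : TC H, (T : H →L[ℂ] H).IsPositive →
    trace (toLin T : K →L[ℂ] K) ≤ trace (T : H →L[ℂ] H)

theorem traceL_one (T : TC H) : traceL 1 T = trace (T : H →L[ℂ] H) := by simp [traceL]

theorem trace_adjoint (T : H →L[ℂ] H) : trace T.adjoint = (starRingEnd ℂ) (trace T) := by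
  rw [trace, trace, Complex.conj_tsum]
  refine tsum_congr fun i => ?_
  rw [ContinuousLinearMap.adjoint_inner_right, inner_conj_symm]

theorem traceL_add (A B : H →L[ℂ] H) (T : TC H) : traceL (A + B) T = traceL A T + traceL B T := by
  simpa [traceL, TC.lmul, add_mul] using trace_add (TC.lmul A T) (TC.lmul B T)

theorem traceL_smul (c : ℂ) (A : H →L[ℂ] H) (T : TC H) : traceL (c • A) T = c * traceL A T := by
  simpa [traceL, TC.lmul] using trace_smul c (TC.lmul A T)

theorem norm_traceL_le (A : H →L[ℂ] H) {P : TC H} (hP : (P : H →L[ℂ] H).IsPositive) :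
    ‖traceL A P‖ ≤ ‖A‖ * (trace (P : H →L[ℂ] H)).re := by
  rcases eq_or_ne A 0 with rfl | hA
  · simp [traceL, trace]
  have hA' : 0 < ‖A‖ := norm_pos_iff.2 hA
  set w := traceL A P with hw
  have ht := Complex.le_def.1 (trace_nonneg hP)
  have hstar : traceL A.adjoint P = (starRingEnd ℂ) w := by
    have h1 : A.adjoint * (P : H →L[ℂ] H) = ((P : H →L[ℂ] H) * A).adjoint := by
      simp only [ContinuousLinearMap.mul_def, ContinuousLinearMap.adjoint_comp,
        (ContinuousLinearMap.isSelfAdjoint_iff'.1 hP.isSelfAdjoint)]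
    simp only [hw, traceL, LinearMap.coe_mk, AddHom.coe_mk]
    rw [h1, trace_adjoint, trace_mul_comm]
  have hAA : (traceL (A.adjoint * A) P).re ≤ ‖A‖ ^ 2 * (trace (P : H →L[ℂ] H)).re := by
    have h0 : 0 ≤ (‖A‖ ^ 2 : ℝ) • (1 : H →L[ℂ] H) - A.adjoint * A := by
      have := CStarAlgebra.star_mul_le_algebraMap_norm_sq (a := A)
      rw [sub_nonneg]
      simpa [Algebra.algebraMap_eq_smul_one, ContinuousLinearMap.star_eq_adjoint] using this
    obtain ⟨B, hB⟩ := CStarAlgebra.nonneg_iff_eq_star_mul_self.1 h0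
    have h2 := (Complex.le_def.1 (traceL_nonneg hP B)).1
    rw [← ContinuousLinearMap.star_eq_adjoint, ← hB] at h2
    have h3 : traceL ((‖A‖ ^ 2 : ℝ) • (1 : H →L[ℂ] H) - A.adjoint * A) P
        = (‖A‖ ^ 2 : ℝ) * trace (P : H →L[ℂ] H) - traceL (A.adjoint * A) P := by
      have e : (‖A‖ ^ 2 : ℝ) • (1 : H →L[ℂ] H) - A.adjoint * A
          = ((‖A‖ ^ 2 : ℝ) : ℂ) • (1 : H →L[ℂ] H) + (-1 : ℂ) • (A.adjoint * A) := by
        rw [neg_one_smul, sub_eq_add_neg]; rfl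
      rw [e, traceL_add, traceL_smul, traceL_smul, traceL_one]; ring
    rw [h3, Complex.sub_re, Complex.re_ofReal_mul] at h2
    simpa using h2
  obtain ⟨u, hu, huw⟩ : ∃ u : ℂ, ‖u‖ = 1 ∧ (starRingEnd ℂ) u * w = ‖w‖ := by
    rcases eq_or_ne w 0 with h | h
    · exact ⟨1, by simp, by simp [h]⟩
    · refine ⟨w / ‖w‖, by simp [h], ?_⟩
      have : (‖w‖ : ℂ) ≠ 0 := by simpa using h
      rw [map_div₀, Complex.conj_ofReal, div_mul_eq_mul_div, mul_comm, Complex.mul_conj']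
      field_simp
  have huw' : u * (starRingEnd ℂ) w = ‖w‖ := by
    have := congrArg (starRingEnd ℂ) huw
    simpa using this
  have huu : (starRingEnd ℂ) u * u = 1 := by rw [mul_comm, Complex.mul_conj', hu]; simp
  have h4 := (Complex.le_def.1 (traceL_nonneg hP (A + (-(‖A‖ : ℂ) * u) • (1 : H →L[ℂ] H)))).1
  have h5 : traceL ((A + (-(‖A‖ : ℂ) * u) • (1 : H →L[ℂ] H)).adjoint *
      (A + (-(‖A‖ : ℂ) * u) • (1 : H →L[ℂ] H))) P = traceL (A.adjoint * A) P
        - ‖A‖ * ‖w‖ - ‖A‖ * ‖w‖ + ‖A‖ ^ 2 * trace (P : H →L[ℂ] H) := by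
    have e : (A + (-(‖A‖ : ℂ) * u) • (1 : H →L[ℂ] H)).adjoint *
      (A + (-(‖A‖ : ℂ) * u) • (1 : H →L[ℂ] H)) = A.adjoint * A + (-(‖A‖ : ℂ) * u) • A.adjoint
        + (-(‖A‖ : ℂ) * (starRingEnd ℂ) u) • A + ((‖A‖ : ℂ) ^ 2 * ((starRingEnd ℂ) u * u)) •
          (1 : H →L[ℂ] H) := by
      rw [← ContinuousLinearMap.star_eq_adjoint, star_add, star_smul, star_one, add_mul, mul_add,
        mul_add, smul_mul_assoc, one_mul, smul_mul_assoc, one_mul, mul_smul_comm, mul_one,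
        smul_smul]
      simp only [star_mul', star_neg, RCLike.star_def, Complex.conj_ofReal]
      rw [add_assoc, add_assoc, add_assoc]
      congr 4
      ring
    rw [e, traceL_add, traceL_add, traceL_add, traceL_smul, traceL_smul, traceL_smul, traceL_one,
      hstar, ← hw, huu, mul_assoc, mul_assoc, huw, huw']
    ring
  rw [h5] at h4
  have h6 : (traceL (A.adjoint * A) P
        - ‖A‖ * ‖w‖ - ‖A‖ * ‖w‖ + ‖A‖ ^ 2 * trace (P : H →L[ℂ] H)).re =
      (traceL (A.adjoint * A) P).re - ‖A‖ * ‖w‖ - ‖A‖ * ‖w‖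
        + ‖A‖ ^ 2 * (trace (P : H →L[ℂ] H)).re := by
    rw [← Complex.ofReal_mul, ← Complex.ofReal_pow]
    simp only [Complex.add_re, Complex.sub_re, Complex.ofReal_re, Complex.re_ofReal_mul]
  rw [h6, Complex.zero_re] at h4
  have h7 : ‖A‖ * ‖w‖ ≤ ‖A‖ * (‖A‖ * (trace (P : H →L[ℂ] H)).re) := by nlinarith
  exact le_of_mul_le_mul_left h7 hA'

/-- `∑ₙ |hₙ⟩⟨hₙ|` with `∑ₙ ‖hₙ‖² < ∞`. -/
theorem exists_square {f : ℕ → H} (hf : Summable (fun n => ‖f n‖ ^ 2)) :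
    ∃ P : TC H, HasSum (fun n => rankOne ℂ (f n) (f n)) (P : H →L[ℂ] H) := by
  have : Summable (fun n => rankOne ℂ (f n) (f n)) := by
    apply Summable.of_norm
    simpa [pow_two] using hf
  exact ⟨⟨_, f, f, by simpa [pow_two] using hf, this.hasSum⟩, this.hasSum⟩

theorem eq_zero_of_square (M : TC H →ₗ[ℂ] ℂ) (C : ℝ)
    (hM : ∀ P : TC H, (P : H →L[ℂ] H).IsPositive → ‖M P‖ ≤ C * (trace (P : H →L[ℂ] H)).re)
    (h0 : ∀ x y, M (TC.ketbra x y) = 0) {f : ℕ → H} (hf : Summable (fun n => ‖f n‖ ^ 2))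
    (P : TC H) (hP : HasSum (fun n => rankOne ℂ (f n) (f n)) (P : H →L[ℂ] H)) : M P = 0 := by
  have key : ∀ N : ℕ, ‖M P‖ ≤ C * ∑' n, ‖f (n + N)‖ ^ 2 := fun N => by
    have hsN : Summable (fun n => ‖f (n + N)‖ * ‖f (n + N)‖) := by
      simpa [pow_two] using (summable_nat_add_iff N).2 hf
    have hR : HasSum (fun n => rankOne ℂ (f (n + N)) (f (n + N)))
        ((P - ∑ n ∈ Finset.range N, TC.ketbra (f n) (f n) : TC H) : H →L[ℂ] H) := by
      have := (hasSum_nat_add_iff' N).2 hP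
      simpa [TC.ketbra] using this
    have hpos : ((P - ∑ n ∈ Finset.range N, TC.ketbra (f n) (f n) : TC H) : H →L[ℂ] H).IsPositive := by
      refine isPositive_of_inner_nonneg fun x => ?_
      have := (hR.mapL (ContinuousLinearMap.apply ℂ H x)).mapL (innerSL ℂ x)
      refine this.nonneg fun n => ?_
      simpa using (isPositive_rankOne_self (𝕜 := ℂ) (f (n + N))).inner_nonneg_right x
    have h1 := hM _ hpos
    rw [map_sub, map_sum, Finset.sum_eq_zero (fun n _ => h0 _ _), sub_zero,
      trace_eq_tsum hsN hR] at h1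
    have h2 : ∑' n, ⟪f (n + N), f (n + N)⟫_ℂ = ((∑' n, ‖f (n + N)‖ ^ 2 : ℝ) : ℂ) := by
      rw [Complex.ofReal_tsum]
      exact tsum_congr fun n => by simp [inner_self_eq_norm_sq_to_K]
    rwa [h2, Complex.ofReal_re] at h1
  have lim : Filter.Tendsto (fun N => C * ∑' n, ‖f (n + N)‖ ^ 2) Filter.atTop (nhds (C * 0)) :=
    (tendsto_sum_nat_add (fun n => ‖f n‖ ^ 2)).const_mul C
  rw [mul_zero] at lim
  exact norm_le_zero_iff.1 (ge_of_tendsto' lim key)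

theorem exists_square_rep (T : TC H) : ∃ f g : ℕ → H, Summable (fun n => ‖f n‖ ^ 2) ∧
    Summable (fun n => ‖g n‖ ^ 2) ∧ HasSum (fun n => rankOne ℂ (f n) (g n)) (T : H →L[ℂ] H) := by
  obtain ⟨f, g, hs, hT⟩ := T.2
  have key : ∀ n, ∃ x y : H, ‖x‖ ^ 2 = ‖f n‖ * ‖g n‖ ∧ ‖y‖ ^ 2 = ‖f n‖ * ‖g n‖ ∧
      rankOne ℂ x y = rankOne ℂ (f n) (g n) := fun n => by
    by_cases h : f n = 0 ∨ g n = 0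
    · exact ⟨0, 0, by rcases h with h | h <;> simp [h], by rcases h with h | h <;> simp [h],
        by rcases h with h | h <;> simp [h]⟩
    · push Not at h
      have hf : 0 < ‖f n‖ := norm_pos_iff.2 h.1
      have hg : 0 < ‖g n‖ := norm_pos_iff.2 h.2
      have hr : 0 < √(‖g n‖ / ‖f n‖) := Real.sqrt_pos.2 (by positivity)
      have hsq : √(‖g n‖ / ‖f n‖) ^ 2 = ‖g n‖ / ‖f n‖ := Real.sq_sqrt (by positivity)
      refine ⟨((√(‖g n‖ / ‖f n‖) : ℝ) : ℂ) • f n, (((√(‖g n‖ / ‖f n‖))⁻¹ : ℝ) : ℂ) • g n,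
        ?_, ?_, ?_⟩
      · rw [norm_smul, Complex.norm_real, Real.norm_of_nonneg hr.le, mul_pow, hsq]
        field_simp
      · rw [norm_smul, Complex.norm_real, Real.norm_of_nonneg (by positivity), mul_pow, inv_pow,
          hsq]
        field_simp
      · have : ((√(‖g n‖ / ‖f n‖) : ℝ) : ℂ) ≠ 0 := by exact_mod_cast hr.ne'
        ext z
        simp only [rankOne_apply, inner_smul_left, Complex.conj_ofReal, smul_smul]
        rw [Complex.ofReal_inv]
        congr 1
        generalize ((√(‖g n‖ / ‖f n‖) : ℝ) : ℂ) = c at this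
        field_simp
  choose x y hx hy hxy using key
  exact ⟨x, y, by simpa only [hx] using hs, by simpa only [hy] using hs,
    by simpa only [hxy] using hT⟩

theorem four_rankOne (x y : H) : (4 : ℂ) • rankOne ℂ x y =
    rankOne ℂ (x + y) (x + y) - rankOne ℂ (x - y) (x - y)
      + Complex.I • rankOne ℂ (x + Complex.I • y) (x + Complex.I • y)
      - Complex.I • rankOne ℂ (x - Complex.I • y) (x - Complex.I • y) := by
  simp only [map_add, map_sub, map_smul, map_smulₛₗ, add_apply, sub_apply, smul_apply,
    smul_add, smul_sub, smul_smul, Complex.conj_I, mul_neg, Complex.I_mul_I, neg_mul]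
  module

/-- A linear functional on `𝒯(H)` that is bounded on positive elements is `tr[B ·]` for some
bounded `B`. -/
theorem exists_eq_traceL (M : TC H →ₗ[ℂ] ℂ) (C : ℝ) (hC : 0 ≤ C)
    (hM : ∀ P : TC H, (P : H →L[ℂ] H).IsPositive → ‖M P‖ ≤ C * (trace (P : H →L[ℂ] H)).re) :
    ∃ B : H →L[ℂ] H, ∀ T, traceL B T = M T := by
  have h4 : ∀ x y, (4 : ℂ) * M (TC.ketbra x y) = M (TC.ketbra (x + y) (x + y))
      - M (TC.ketbra (x - y) (x - y))
      + Complex.I * M (TC.ketbra (x + Complex.I • y) (x + Complex.I • y))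
      - Complex.I * M (TC.ketbra (x - Complex.I • y) (x - Complex.I • y)) := fun x y => by
    simp only [← smul_eq_mul, ← map_smul, ← map_add, ← map_sub]
    congr 1
    exact Subtype.ext (four_rankOne x y)
  have hd : ∀ z, ‖M (TC.ketbra z z)‖ ≤ C * ‖z‖ ^ 2 := fun z => by
    have := hM (TC.ketbra z z) (isPositive_rankOne_self z)
    rw [← traceL_one, traceL_ketbra] at this
    simpa [inner_self_eq_norm_sq_to_K, ← Complex.ofReal_pow] using this
  have hb1 : ∀ x y, ‖x‖ = 1 → ‖y‖ = 1 → ‖M (TC.ketbra x y)‖ ≤ 4 * C := fun x y hx hy => by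
    have hz : ∀ z, ‖z‖ ≤ 2 → ‖M (TC.ketbra z z)‖ ≤ C * 4 := fun z hz => by
      refine (hd z).trans (mul_le_mul_of_nonneg_left ?_ hC)
      nlinarith [norm_nonneg z]
    have hIy : ‖Complex.I • y‖ = 1 := by simp [norm_smul, hy]
    have e1 := hz (x + y) ((norm_add_le _ _).trans (by rw [hx, hy]; norm_num))
    have e2 := hz (x - y) ((norm_sub_le _ _).trans (by rw [hx, hy]; norm_num))
    have e3 := hz (x + Complex.I • y) ((norm_add_le _ _).trans (by rw [hx, hIy]; norm_num))
    have e4 := hz (x - Complex.I • y) ((norm_sub_le _ _).trans (by rw [hx, hIy]; norm_num))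
    have e5 : ‖(4 : ℂ) * M (TC.ketbra x y)‖ ≤ C * 4 + C * 4 + C * 4 + C * 4 := by
      rw [h4]
      refine (norm_sub_le _ _).trans (add_le_add ((norm_add_le _ _).trans (add_le_add
        ((norm_sub_le _ _).trans (add_le_add e1 e2)) ?_)) ?_)
      · simpa using e3
      · simpa using e4
    rw [norm_mul] at e5
    norm_num at e5
    linarith
  have hb : ∀ x y, ‖M (TC.ketbra x y)‖ ≤ 4 * C * ‖y‖ * ‖x‖ := fun x y => by
    by_cases h : x = 0 ∨ y = 0
    · have : TC.ketbra x y = 0 := Subtype.ext (by rcases h with h | h <;> simp [TC.ketbra, h])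
      rw [this, map_zero, norm_zero]; positivity
    · push Not at h
      have hx : ‖x‖ ≠ 0 := norm_ne_zero_iff.2 h.1
      have hy : ‖y‖ ≠ 0 := norm_ne_zero_iff.2 h.2
      have e : TC.ketbra x y = ((‖x‖ : ℂ) * (‖y‖ : ℂ)) •
          TC.ketbra (((‖x‖⁻¹ : ℝ) : ℂ) • x) (((‖y‖⁻¹ : ℝ) : ℂ) • y) := Subtype.ext (by
        have hx' : (‖x‖ : ℂ) ≠ 0 := by exact_mod_cast hx
        have hy' : (‖y‖ : ℂ) ≠ 0 := by exact_mod_cast hy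
        ext z
        simp only [TC.ketbra, Submodule.coe_smul, smul_apply, rankOne_apply,
          inner_smul_left, Complex.conj_ofReal, smul_smul]
        rw [Complex.ofReal_inv, Complex.ofReal_inv]
        congr 1
        field_simp)
      have := hb1 (((‖x‖⁻¹ : ℝ) : ℂ) • x) (((‖y‖⁻¹ : ℝ) : ℂ) • y)
        (by rw [norm_smul, Complex.norm_real]; simp [hx])
        (by rw [norm_smul, Complex.norm_real]; simp [hy])
      rw [e, map_smul, norm_smul, norm_mul, Complex.norm_real, Complex.norm_real, norm_norm,
        norm_norm]
      nlinarith [mul_nonneg (norm_nonneg x) (norm_nonneg y)]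
  let F : H →L⋆[ℂ] H →L[ℂ] ℂ := LinearMap.mkContinuous₂
    (LinearMap.mk₂'ₛₗ (starRingEnd ℂ) (RingHom.id ℂ) (fun y x => M (TC.ketbra x y))
      (fun y y' x => by rw [← map_add]; congr 1; exact Subtype.ext (by simp [TC.ketbra]))
      (fun c y x => by
        rw [smul_eq_mul, ← smul_eq_mul, ← map_smul]; congr 1
        exact Subtype.ext (by simp [TC.ketbra]))
      (fun y x x' => by rw [← map_add]; congr 1; exact Subtype.ext (by simp [TC.ketbra]))
      (fun c y x => by
        rw [RingHom.id_apply, ← map_smul]; congr 1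
        exact Subtype.ext (by simp [TC.ketbra])))
    (4 * C) (fun y x => by simpa using hb x y)
  refine ⟨(continuousLinearMapOfBilin F).adjoint, fun T => ?_⟩
  set B := (continuousLinearMapOfBilin F).adjoint with hB
  have h0 : ∀ x y, (M - traceL B) (TC.ketbra x y) = 0 := fun x y => by
    rw [LinearMap.sub_apply, traceL_ketbra, hB, ContinuousLinearMap.adjoint_inner_right,
      continuousLinearMapOfBilin_apply]
    simp [F]
  have hN : ∀ P : TC H, (P : H →L[ℂ] H).IsPositive →
      ‖(M - traceL B) P‖ ≤ (C + ‖B‖) * (trace (P : H →L[ℂ] H)).re := fun P hP => by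
    rw [add_mul]
    exact (norm_sub_le _ _).trans (add_le_add (hM P hP) (norm_traceL_le B hP))
  obtain ⟨f, g, hf, hg, hT⟩ := exists_square_rep T
  have hsum : ∀ c : ℂ, Summable (fun n => ‖f n + c • g n‖ ^ 2) := fun c => by
    refine ((hf.add (hg.mul_left (‖c‖ ^ 2))).mul_left 2).of_nonneg_of_le
      (fun n => by positivity) fun n => ?_
    have h1 : ‖f n + c • g n‖ ≤ ‖f n‖ + ‖c‖ * ‖g n‖ :=
      (norm_add_le _ _).trans (by rw [norm_smul])
    have h2 : ‖f n + c • g n‖ ^ 2 ≤ (‖f n‖ + ‖c‖ * ‖g n‖) ^ 2 := by gcongr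
    nlinarith [sq_nonneg (‖f n‖ - ‖c‖ * ‖g n‖)]
  choose P hP using fun c => exists_square (hsum c)
  have hPz : ∀ c, (M - traceL B) (P c) = 0 := fun c =>
    eq_zero_of_square _ _ hN h0 (hsum c) (P c) (hP c)
  have hdec : (4 : ℂ) • T = P 1 - P (-1) + Complex.I • P Complex.I - Complex.I • P (-Complex.I) := by
    apply Subtype.ext
    refine (hT.const_smul (4 : ℂ)).unique ?_
    have := (((hP 1).sub (hP (-1))).add ((hP Complex.I).const_smul Complex.I)).sub
      ((hP (-Complex.I)).const_smul Complex.I)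
    refine this.congr_fun fun n => ?_
    rw [four_rankOne]
    simp [sub_eq_add_neg]
  have h5 : (4 : ℂ) • (M - traceL B) T = 0 := by
    rw [← map_smul, hdec]
    simp only [map_add, map_sub, map_smul, hPz]
    simp
  have h6 : (M - traceL B) T = 0 := by simpa using h5
  rw [LinearMap.sub_apply, sub_eq_zero] at h6
  exact h6.symm

theorem Operation.exists_dual (Φ : Operation H K) (A : K →L[ℂ] K) :
    ∃ B : H →L[ℂ] H, ∀ T : TC H,
      trace (B * (T : H →L[ℂ] H)) = trace (A * (Φ.toLin T : K →L[ℂ] K)) := by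
  obtain ⟨B, hB⟩ := exists_eq_traceL (traceL A ∘ₗ Φ.toLin) ‖A‖ (norm_nonneg A) fun P hP => by
    refine (norm_traceL_le A (Φ.cp.isPositive hP)).trans ?_
    gcongr
    exact Φ.trace_le P hP
  exact ⟨B, hB⟩

end Operations

section Dual

variable {H K : Type*} [NormedAddCommGroup H] [InnerProductSpace ℂ H] [CompleteSpace H]
  [NormedAddCommGroup K] [InnerProductSpace ℂ K] [CompleteSpace K]

/-- A bounded operator is determined by its trace pairing with `𝒯(H)`. -/
theorem ext_trace_left {A B : H →L[ℂ] H} (h : ∀ T : TC H,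
    trace (A * (T : H →L[ℂ] H)) = trace (B * (T : H →L[ℂ] H))) : A = B := by
  ext x
  refine ext_inner_left ℂ fun y => ?_
  rw [← traceL_ketbra, ← traceL_ketbra]
  exact h _

/-- A trace-class operator is determined by its trace pairing with bounded operators. -/
theorem ext_trace_right {S T : TC H} (h : ∀ A : H →L[ℂ] H,
    trace (A * (S : H →L[ℂ] H)) = trace (A * (T : H →L[ℂ] H))) : S = T := by
  apply Subtype.ext
  ext x
  refine ext_inner_left ℂ fun y => ?_
  have key : ∀ R : TC H, trace (rankOne ℂ x y * (R : H →L[ℂ] H)) = ⟪y, (R : H →L[ℂ] H) x⟫_ℂ :=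
    fun R => by
      have h1 := trace_mul_comm (rankOne ℂ x y) R
      rw [← h1]
      exact traceL_ketbra (R : H →L[ℂ] H) x y
  rw [← key, ← key]
  exact h _

/-- The dual (Heisenberg picture) map `Φ* : ℒ(K) → ℒ(H)`, determined by
`tr[Φ*(A) T] = tr[A Φ(T)]` for all `T ∈ 𝒯(H)`. -/
def Operation.dual (Φ : Operation H K) (A : K →L[ℂ] K) : H →L[ℂ] H := (Φ.exists_dual A).choose

theorem Operation.dual_spec (Φ : Operation H K) (A : K →L[ℂ] K) (T : TC H) :
    trace (Φ.dual A * (T : H →L[ℂ] H)) = trace (A * (Φ.toLin T : K →L[ℂ] K)) :=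
  (Φ.exists_dual A).choose_spec T

/-- Channels: trace-preserving operations. -/
def Operation.IsChannel (Φ : Operation H K) : Prop :=
  ∀ T : TC H, trace (Φ.toLin T : K →L[ℂ] K) = trace (T : H →L[ℂ] H)

/-- The fixed-point set `{A ∈ ℒ(H) | Φ*(A) = A}` of the dual of `Φ`. -/
def Operation.fixedPoints (Φ : Operation H H) : Set (H →L[ℂ] H) := {A | Φ.dual A = A}

end Dual

section Tensor

variable {H K : Type*} [NormedAddCommGroup H] [InnerProductSpace ℂ H]
  [NormedAddCommGroup K] [InnerProductSpace ℂ K]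

/-- The Hilbert space tensor product: the completion of the algebraic tensor product for the
norm of the inner product `⟪a ⊗ b, c ⊗ d⟫ = ⟪a, c⟫ ⟪b, d⟫`. -/
abbrev HTensor (H K : Type*) [NormedAddCommGroup H] [InnerProductSpace ℂ H]
    [NormedAddCommGroup K] [InnerProductSpace ℂ K] : Type _ :=
  UniformSpace.Completion (H ⊗[ℂ] K)

/-- The simple tensor `x ⊗ y` in the Hilbert space tensor product. -/
def simpleTensor (x : H) (y : K) : HTensor H K := ((x ⊗ₜ[ℂ] y : H ⊗[ℂ] K) : HTensor H K)

/-- The operator `A ⊗ B` on the Hilbert space tensor product. -/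
def opTensor (A : H →L[ℂ] H) (B : K →L[ℂ] K) : HTensor H K →L[ℂ] HTensor H K :=
  (TensorProduct.mapL A B).completion

theorem opTensor_simpleTensor (A : H →L[ℂ] H) (B : K →L[ℂ] K) (x : H) (y : K) :
    opTensor A B (simpleTensor x y) = simpleTensor (A x) (B y) := by
  simp [opTensor, simpleTensor, ContinuousLinearMap.completion_apply_coe]

theorem inner_simpleTensor (x x' : H) (y y' : K) :
    ⟪simpleTensor x y, simpleTensor x' y'⟫_ℂ = ⟪x, x'⟫_ℂ * ⟪y, y'⟫_ℂ := by
  simp [simpleTensor]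

theorem norm_simpleTensor (x : H) (y : K) : ‖simpleTensor x y‖ = ‖x‖ * ‖y‖ := by
  simp [simpleTensor]

/-- The simple tensors span a dense subspace. -/
theorem dense_simpleTensor :
    Dense (Submodule.span ℂ {z : HTensor H K | ∃ x y, z = simpleTensor x y} : Set (HTensor H K)) := by
  refine (UniformSpace.Completion.denseRange_coe (α := H ⊗[ℂ] K)).mono ?_
  rintro _ ⟨t, rfl⟩
  induction t with
  | zero => exact Submodule.zero_mem _
  | tmul x y => exact Submodule.subset_span ⟨x, y, rfl⟩
  | add a b ha hb =>
    rw [UniformSpace.Completion.coe_add]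
    exact Submodule.add_mem _ ha hb

theorem ext_simpleTensor {S T : HTensor H K →L[ℂ] HTensor H K}
    (h : ∀ x y, S (simpleTensor x y) = T (simpleTensor x y)) : S = T := by
  refine ContinuousLinearMap.ext_on dense_simpleTensor ?_
  rintro _ ⟨x, y, rfl⟩
  exact h x y

theorem inner_ext_simpleTensor {v w : HTensor H K}
    (h : ∀ x y, ⟪simpleTensor x y, v⟫_ℂ = ⟪simpleTensor x y, w⟫_ℂ) : v = w := by
  have : (innerSL ℂ).flip v = (innerSL ℂ).flip w := by
    refine ContinuousLinearMap.ext_on dense_simpleTensor ?_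
    rintro _ ⟨x, y, rfl⟩
    exact h x y
  exact ext_inner_left ℂ fun u => DFunLike.congr_fun this u

theorem isTraceClass_opTensor {S : H →L[ℂ] H} {T : K →L[ℂ] K} (hS : IsTraceClass S)
    (hT : IsTraceClass T) : IsTraceClass (opTensor S T) := by
  obtain ⟨f, g, hs, hS⟩ := hS
  obtain ⟨f', g', hs', hT⟩ := hT
  have hn : Summable (fun p : ℕ × ℕ =>
      ‖simpleTensor (f p.1) (f' p.2)‖ * ‖simpleTensor (g p.1) (g' p.2)‖) := by
    refine (hs.mul_of_nonneg hs' (fun n => by positivity) (fun n => by positivity)).congr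
      fun p => ?_
    simp only [norm_simpleTensor]; ring
  have hsum : Summable (fun p : ℕ × ℕ =>
      rankOne ℂ (simpleTensor (f p.1) (f' p.2)) (simpleTensor (g p.1) (g' p.2))) := by
    apply Summable.of_norm
    simpa using! hn
  refine IsTraceClass.of_hasSum hn ?_
  convert hsum.hasSum using 1
  refine ext_simpleTensor fun x y => inner_ext_simpleTensor fun x' y' => ?_
  have h1 : HasSum (fun n => ⟪x', f n⟫_ℂ * ⟪g n, x⟫_ℂ) ⟪x', S x⟫_ℂ := by
    have := (hS.mapL (ContinuousLinearMap.apply ℂ H x)).mapL (innerSL ℂ x')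
    simpa [inner_smul_right, mul_comm] using this
  have h2 : HasSum (fun n => ⟪y', f' n⟫_ℂ * ⟪g' n, y⟫_ℂ) ⟪y', T y⟫_ℂ := by
    have := (hT.mapL (ContinuousLinearMap.apply ℂ K y)).mapL (innerSL ℂ y')
    simpa [inner_smul_right, mul_comm] using this
  have h3 := (hsum.hasSum.mapL (ContinuousLinearMap.apply ℂ _ (simpleTensor x y))).mapL
    (innerSL ℂ (simpleTensor x' y'))
  have h4 : HasSum (fun p : ℕ × ℕ => (⟪x', f p.1⟫_ℂ * ⟪g p.1, x⟫_ℂ) *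
      (⟪y', f' p.2⟫_ℂ * ⟪g' p.2, y⟫_ℂ))
      ⟪simpleTensor x' y', (∑' p : ℕ × ℕ, rankOne ℂ (simpleTensor (f p.1) (f' p.2))
        (simpleTensor (g p.1) (g' p.2))) (simpleTensor x y)⟫_ℂ := by
    refine HasSum.congr_fun h3 fun p => ?_
    simp [inner_simpleTensor]; ring
  have h5 := h1.mul_eq h2 h4
  rw [opTensor_simpleTensor, inner_simpleTensor]
  exact h5

/-- `S ⊗ T` as a trace-class operator. -/
def TC.tensor (S : TC H) (T : TC K) : TC (HTensor H K) :=
  ⟨opTensor (S : H →L[ℂ] H) (T : K →L[ℂ] K), isTraceClass_opTensor S.2 T.2⟩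

end Tensor

section PartialTrace

variable {H K : Type*} [NormedAddCommGroup H] [InnerProductSpace ℂ H] [CompleteSpace H]
  [NormedAddCommGroup K] [InnerProductSpace ℂ K] [CompleteSpace K]

/-- The isometry `x ↦ x ⊗ e` for a unit vector `e`. -/
def ampl (e : K) (he : ‖e‖ = 1) : H →ₗᵢ[ℂ] HTensor H K where
  toFun x := simpleTensor x e
  map_add' x y := by
    simp only [simpleTensor, TensorProduct.add_tmul]
    exact UniformSpace.Completion.coe_add _ _
  map_smul' c x := by
    simp only [simpleTensor, ← TensorProduct.smul_tmul', RingHom.id_apply]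
    exact UniformSpace.Completion.coe_smul c _
  norm_map' x := by
    change ‖simpleTensor x e‖ = ‖x‖
    rw [norm_simpleTensor, he, mul_one]

theorem isHilbertSum_ampl {ι : Type*} (b : HilbertBasis ι ℂ K) :
    IsHilbertSum ℂ (fun _ : ι => H) (fun i => ampl (b i) (b.orthonormal.1 i)) := by
  refine IsHilbertSum.mk ?_ ?_
  · intro i j hij x y
    change ⟪simpleTensor x (b i), simpleTensor y (b j)⟫_ℂ = 0
    rw [inner_simpleTensor, b.orthonormal.2 hij, mul_zero]
  · rintro z -
    set W := (⨆ i, LinearMap.range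
      (ampl (H := H) (b i) (b.orthonormal.1 i)).toLinearMap).topologicalClosure with hW
    have hclosed : IsClosed (W : Set (HTensor H K)) := Submodule.isClosed_topologicalClosure _
    have hst : ∀ x y, simpleTensor x y ∈ W := fun x y => by
      have h1 := b.hasSum_repr y
      have h2 : HasSum (fun i => simpleTensor x (b.repr y i • b i)) (simpleTensor x y) := by
        have := (h1.mapL (TensorProduct.mkL ℂ H K x)).mapL
          (UniformSpace.Completion.toComplL (𝕜 := ℂ) (E := H ⊗[ℂ] K))
        exact this
      refine hclosed.mem_of_tendsto h2 (Filter.Eventually.of_forall fun s => ?_)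
      refine Submodule.sum_mem _ fun i _ => ?_
      have : simpleTensor x (b.repr y i • b i) = ampl (b i) (b.orthonormal.1 i) (b.repr y i • x) := by
        change simpleTensor _ _ = simpleTensor _ _
        simp only [simpleTensor, TensorProduct.smul_tmul]
      rw [this]
      exact Submodule.le_topologicalClosure _ (Submodule.mem_iSup_of_mem i ⟨_, rfl⟩)
    have hle : Submodule.span ℂ {z : HTensor H K | ∃ x y, z = simpleTensor x y} ≤ W := by
      rw [Submodule.span_le]
      rintro _ ⟨x, y, rfl⟩
      exact hst x y
    have h3 := dense_simpleTensor (H := H) (K := K) z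
    exact closure_minimal hle hclosed h3

theorem exists_partialTrace (S : TC (HTensor H K)) : ∃ R : TC H, ∀ A : H →L[ℂ] H,
    trace (A * (R : H →L[ℂ] H)) = trace (opTensor A 1 * (S : HTensor H K →L[ℂ] HTensor H K)) := by
  obtain ⟨F, G, hs, hS⟩ := S.2
  obtain ⟨w, b, -⟩ := exists_hilbertBasis ℂ K
  have hV := isHilbertSum_ampl (H := H) b
  set U := hV.linearIsometryEquiv with hU
  have hbound : ∀ u v : HTensor H K, ∀ s : Finset w,
      ∑ i ∈ s, ‖U u i‖ * ‖U v i‖ ≤ ‖u‖ * ‖v‖ := fun u v s => by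
    have h2 : ∀ u : HTensor H K, ∑ i ∈ s, ‖U u i‖ ^ 2 ≤ ‖u‖ ^ 2 := fun u => by
      have := lp.sum_rpow_le_norm_rpow (p := 2) (by simp) (U u) s
      simpa using this
    calc ∑ i ∈ s, ‖U u i‖ * ‖U v i‖
        ≤ √(∑ i ∈ s, ‖U u i‖ ^ 2) * √(∑ i ∈ s, ‖U v i‖ ^ 2) :=
          Real.sum_mul_le_sqrt_mul_sqrt _ _ _
      _ ≤ √(‖u‖ ^ 2) * √(‖v‖ ^ 2) := by gcongr <;> exact h2 _
      _ = ‖u‖ * ‖v‖ := by simp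
  have hn : Summable (fun p : ℕ × w => ‖U (F p.1) p.2‖ * ‖U (G p.1) p.2‖) := by
    rw [summable_prod_of_nonneg (fun _ => by positivity)]
    refine ⟨fun n => summable_of_sum_le (fun _ => by positivity) (hbound (F n) (G n)), ?_⟩
    refine hs.of_nonneg_of_le (fun n => tsum_nonneg fun _ => by positivity) fun n => ?_
    exact Real.tsum_le_of_sum_le (fun _ => by positivity) (hbound (F n) (G n))
  have hsum : Summable (fun p : ℕ × w => rankOne ℂ (U (F p.1) p.2) (U (G p.1) p.2)) := by
    apply Summable.of_norm
    simpa using! hn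
  refine ⟨⟨_, IsTraceClass.of_hasSum hn hsum.hasSum⟩, fun A => ?_⟩
  have h1 := hasSum_trace_mul hn hsum.hasSum A
  have h2 := hasSum_trace_mul hs hS (opTensor A 1)
  have h3 : ∀ n, HasSum (fun i => ⟪U (G n) i, A (U (F n) i)⟫_ℂ)
      ⟪G n, opTensor A 1 (F n)⟫_ℂ := fun n => by
    have e1 := hV.hasSum_linearIsometryEquiv_symm (U (F n))
    rw [← hU, U.symm_apply_apply] at e1
    have e2 := (e1.mapL (opTensor A (1 : K →L[ℂ] K))).mapL (innerSL ℂ (G n))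
    refine HasSum.congr_fun e2 fun i => ?_
    classical
    have e3 : opTensor A (1 : K →L[ℂ] K) (ampl (b i) (b.orthonormal.1 i) (U (F n) i)) =
        ampl (b i) (b.orthonormal.1 i) (A (U (F n) i)) := opTensor_simpleTensor _ _ _ _
    have e4 : ampl (b i) (b.orthonormal.1 i) (A (U (F n) i)) =
        U.symm (lp.single 2 i (A (U (F n) i))) :=
      (hV.linearIsometryEquiv_symm_apply_single _).symm
    rw [innerSL_apply_apply, e3, e4, ← U.inner_map_map, U.apply_symm_apply, lp.inner_single_right]
  exact (h1.prod_fiberwise h3).unique h2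

/-- The partial trace over `K`, determined by `tr[A tr_K[S]] = tr[(A ⊗ 1) S]` for all
`A ∈ ℒ(H)`. -/
def partialTrace (S : TC (HTensor H K)) : TC H := (exists_partialTrace S).choose

theorem partialTrace_spec (S : TC (HTensor H K)) (A : H →L[ℂ] H) :
    trace (A * (partialTrace S : H →L[ℂ] H)) =
      trace (opTensor A 1 * (S : HTensor H K →L[ℂ] HTensor H K)) :=
  (exists_partialTrace S).choose_spec A

end PartialTrace

section Measurement

variable {H K X Y : Type*} [NormedAddCommGroup H] [InnerProductSpace ℂ H] [CompleteSpace H]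
  [NormedAddCommGroup K] [InnerProductSpace ℂ K] [CompleteSpace K]

/-- States: positive trace-class operators of unit trace. -/
structure State (H : Type*) [NormedAddCommGroup H] [InnerProductSpace ℂ H] [CompleteSpace H] where
  op : TC H
  pos : (op : H →L[ℂ] H).IsPositive
  trace_eq_one : trace (op : H →L[ℂ] H) = 1

/-- Discrete observables with outcome set `X`: families of positive operators `E x` with
`∑ₓ E x = 1` (weakly). -/
structure Observable (X H : Type*) [NormedAddCommGroup H] [InnerProductSpace ℂ H]
    [CompleteSpace H] where
  effect : X → (H →L[ℂ] H)
  pos : ∀ x, (effect x).IsPositive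
  hasSum_one : ∀ φ ψ : H, HasSum (fun x => ⟪φ, effect x ψ⟫_ℂ) ⟪φ, ψ⟫_ℂ

/-- All effects of `E` commute with the operator `A`. -/
def Observable.CommutesWith (E : Observable X H) (A : H →L[ℂ] H) : Prop :=
  ∀ x, Commute (E.effect x) A

/-- All effects of `E` commute with all effects of `F`. -/
def Observable.CommutesWithObs (E : Observable X H) (F : Observable Y H) : Prop :=
  ∀ x y, Commute (E.effect x) (F.effect y)

/-- The effects of `E` commute with each other. -/
def Observable.IsCommutative (E : Observable X H) : Prop := E.CommutesWithObs E

/-- Sharp observables: `E x * E y = δ_{xy} E x`. -/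
def Observable.IsSharp (E : Observable X H) : Prop :=
  (∀ x, E.effect x * E.effect x = E.effect x) ∧
    ∀ x y, x ≠ y → E.effect x * E.effect y = 0

/-- Discrete instruments with outcome set `X`: operations `I x` whose sum `∑ₓ I x` is a channel
(`total`). The sum is required to converge weakly in `𝒯(H)`; as the maps are positive and `total`
preserves the trace, this is the same as convergence in trace norm. -/
structure Instrument (X H : Type*) [NormedAddCommGroup H] [InnerProductSpace ℂ H]
    [CompleteSpace H] where
  op : X → Operation H H
  total : Operation H H
  isChannel_total : total.IsChannel
  hasSum_total : ∀ (T : TC H) (A : H →L[ℂ] H),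
    HasSum (fun x => trace (A * ((op x).toLin T : H →L[ℂ] H)))
      (trace (A * (total.toLin T : H →L[ℂ] H)))

/-- `I` is an `E`-instrument: `I_x*(1) = E x`, i.e. `tr[I_x(ρ)] = tr[E x ρ]`. -/
def Instrument.IsCompatible (I : Instrument X H) (E : Observable X H) : Prop :=
  ∀ x, (I.op x).dual 1 = E.effect x

/-- `I` does not disturb `F`: `I_X*(F y) = F y` for all outcomes `y`. -/
def Instrument.NotDisturbs (I : Instrument X H) (F : Observable Y H) : Prop :=
  ∀ y, I.total.dual (F.effect y) = F.effect y

/-- The `E`-instrument `I` is a measurement of the first kind: it does not disturb `E`. -/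
def Instrument.IsFirstKind (I : Instrument X H) (E : Observable X H) : Prop := I.NotDisturbs E

/-- Repeatability: `tr[I_y(I_x(ρ))] = δ_{xy} tr[I_x(ρ)]` for all states `ρ`. -/
def Instrument.IsRepeatable (I : Instrument X H) : Prop :=
  ∀ ρ : State H,
    (∀ x, trace ((I.op x).toLin ((I.op x).toLin ρ.op) : H →L[ℂ] H) =
      trace ((I.op x).toLin ρ.op : H →L[ℂ] H)) ∧
    ∀ x y, x ≠ y → trace ((I.op y).toLin ((I.op x).toLin ρ.op) : H →L[ℂ] H) = 0

/-- Measurement schemes `(K, ξ, ℰ, Z)` for a system `H`: an apparatus `K` with state `ξ`, an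
interaction channel `ℰ` on `𝒯(H ⊗ K)` and a pointer observable `Z` of the apparatus. -/
structure MeasurementScheme (X H K : Type*) [NormedAddCommGroup H] [InnerProductSpace ℂ H]
    [CompleteSpace H] [NormedAddCommGroup K] [InnerProductSpace ℂ K] [CompleteSpace K] where
  state : State K
  interaction : Operation (HTensor H K) (HTensor H K)
  isChannel_interaction : interaction.IsChannel
  pointer : Observable X K

/-- `M` is a measurement scheme for `I`: `I_x(T) = tr_K[(1 ⊗ Z x) ℰ(T ⊗ ξ)]`. -/
def MeasurementScheme.Implements (M : MeasurementScheme X H K) (I : Instrument X H) : Prop :=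
  ∀ (x : X) (T : TC H), (I.op x).toLin T =
    partialTrace (TC.lmul (opTensor 1 (M.pointer.effect x))
      (M.interaction.toLin (TC.tensor T M.state.op)))

/-- The channel `Φ` conserves `N` on average: `tr[N Φ(ρ)] = tr[N ρ]` for all states `ρ`. -/
def Operation.ConservesOnAverage (Φ : Operation H H) (N : H →L[ℂ] H) : Prop :=
  ∀ ρ : State H, trace (N * (Φ.toLin ρ.op : H →L[ℂ] H)) = trace (N * (ρ.op : H →L[ℂ] H))

/-- The additive quantity `N_S ⊗ 1 + 1 ⊗ N_A`. -/
def additive (NS : H →L[ℂ] H) (NA : K →L[ℂ] K) : HTensor H K →L[ℂ] HTensor H K :=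
  opTensor NS 1 + opTensor 1 NA

end Measurement

end

end QMeas

/-! Let Γ be the dual of the channel T ↦ ℰ(T ⊗ ξ) (`M.channel.dual`). It is unital and completely
positive, and it encodes the whole measurement: Γ(A ⊗ Z(x)) = I_x*(A), and summing over x gives Γ(A
⊗ 1) = I_X*(A). In particular Γ(1 ⊗ Z(x)) = E(x).

If A is a fixed point of I_X*, then A*A and AA* are fixed as well, because the fixed points form an
algebra closed under adjoints. Hence Γ(A*A ⊗ 1) = Γ(A ⊗ 1)* Γ(A ⊗ 1), and likewise for AA*. By
Choi's multiplicative-domain argument (`dual_mul_right`, `dual_mul_left`), Γ is then a bimodule map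
over fixed points: Γ(C (A ⊗ 1)) = Γ(C) A and Γ((A ⊗ 1) C) = A Γ(C). Since A ⊗ 1 commutes with 1 ⊗ B,
every fixed point commutes with every Γ(1 ⊗ B) (`commute_dual_channel`).

Part (i) takes two choices of B. The pointer effect B = Z(x) gives commutation with E(x). For B =
N_A, conservation on average reads Γ(N) = N_S + tr[N_A ξ] 1, so ΔN_S = tr[N_A ξ] 1 - Γ(1 ⊗ N_A), and
fixed points commute with ΔN_S.

For part (ii), E(x) is itself a fixed point. Then I_X*([E(x), N_S]) = [E(x), I_X*(N_S)] = [E(x),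
N_S] + [E(x), ΔN_S] = [E(x), N_S]. The commutator is thus a fixed point and commutes with E(x). A
self-adjoint e that commutes with [e, n] commutes with n (`commute_of_commute_commutator`).

For part (iii), repeatability means I_y*(E(x)) = δ_{xy} E(x), which implies the first-kind property.
The bimodule property turns E(x)E(y) = E(x) Γ(1 ⊗ Z(y)) into I_y*(E(x)), which is sharpness. -/

namespace QMeas

open scoped ComplexOrder InnerProductSpace TensorProduct
open InnerProductSpace

noncomputable section

/-! ### Self-adjoint elements commuting with their own commutators -/

section CommutatorLemma

/-- A self-adjoint element of a C⋆-algebra which commutes with its commutator with `n` commutes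
with `n`. -/
theorem commute_of_commute_commutator {A : Type*} [CStarAlgebra A] {e n : A}
    (he : IsSelfAdjoint e) (h : Commute e (e * n - n * e)) : Commute e n := by
  -- Unitaries have norm one only in a nontrivial algebra, so the zero algebra is treated apart.
  rcases subsingleton_or_nontrivial A with _ | _
  · exact Subsingleton.elim (e * n) (n * e)
  let _ : NormedAlgebra ℚ A := NormedAlgebra.restrictScalars ℚ ℂ A
  -- With u(t) = exp(ite), the conjugate u(t) n u(-t) has derivative u(t) d u(-t) for d = i[e, n].
  -- This equals d because e commutes with d. So the conjugate is n + td, growing linearly unless d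
  -- = 0, while its norm stays at most ‖n‖ since u(t) is unitary.
  obtain ⟨d, hd⟩ : ∃ d, d = Complex.I • (e * n - n * e) := ⟨_, rfl⟩
  set u : ℝ → A := fun t => NormedSpace.exp (t • (Complex.I • e)) with hu
  have hu1 : ∀ t, HasDerivAt u (u t * (Complex.I • e)) t := fun t =>
    hasDerivAt_exp_smul_const (𝕂 := ℝ) (Complex.I • e) t
  have hv1 : ∀ t : ℝ, HasDerivAt (fun s : ℝ => u (-s)) (-((Complex.I • e) * u (-t))) t := fun t => by
    have := (hasDerivAt_exp_smul_const' (𝕂 := ℝ) (Complex.I • e) (-t)).scomp t (hasDerivAt_neg t)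
    simpa [Function.comp_def, hu] using! this
  have hcomm : Commute (Complex.I • e) d := by
    rw [hd]
    exact (h.smul_left Complex.I).smul_right Complex.I
  have hud : ∀ t, u t * d * u (-t) = d := fun t => by
    have h1 : Commute (u t) d := ((hcomm.smul_left t).exp_left)
    rw [h1.eq, mul_assoc, hu]
    simp only
    rw [← NormedSpace.exp_add_of_commute]
    · simp
    · exact ((Commute.refl _).smul_left _).smul_right _
  have hder : ∀ t, HasDerivAt (fun s => u s * n * u (-s) - s • d) 0 t := fun t => by
    have h1 := (((hu1 t).mul_const n).mul (hv1 t)).sub ((hasDerivAt_id t).smul_const d)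
    have h2 : u t * (Complex.I • e) * n * u (-t) + u t * n * -((Complex.I • e) * u (-t))
        - (1 : ℝ) • d = 0 := by
      rw [one_smul, sub_eq_zero, ← hud t, hd]
      simp only [smul_sub, mul_sub, sub_mul, mul_smul_comm, smul_mul_assoc, mul_neg, mul_assoc]
      abel
    rw [h2] at h1
    exact h1
  have hconst : ∀ t : ℝ, u t * n * u (-t) = n + t • d := fun t => by
    have := is_const_of_deriv_eq_zero (fun t => (hder t).differentiableAt)
      (fun t => (hder t).deriv) t 0
    simp only [hu, zero_smul, neg_zero, NormedSpace.exp_zero, one_mul, mul_one, sub_zero] at this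
    rw [sub_eq_iff_eq_add] at this
    exact this
  have hnorm : ∀ t, ‖u t‖ ≤ 1 := fun t => by
    have h1 : IsSelfAdjoint (t • e) := (IsSelfAdjoint.all t).smul he
    have h2 := (selfAdjoint.expUnitary ⟨t • e, h1⟩).2
    have h3 : u t = (selfAdjoint.expUnitary ⟨t • e, h1⟩ : A) := by
      rw [selfAdjoint.expUnitary_coe, hu]
      simp only [smul_comm t Complex.I e]
    rw [h3]
    exact (CStarRing.norm_of_mem_unitary h2).le
  have hb : ∀ t : ℝ, 0 < t → ‖d‖ ≤ (‖n‖ + ‖n‖) / t := fun t ht => by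
    rw [le_div_iff₀ ht]
    calc ‖d‖ * t = ‖t • d‖ := by rw [norm_smul, Real.norm_of_nonneg ht.le, mul_comm]
      _ = ‖u t * n * u (-t) - n‖ := by rw [hconst]; congr 1; abel
      _ ≤ ‖u t * n * u (-t)‖ + ‖n‖ := norm_sub_le _ _
      _ ≤ 1 * ‖n‖ * 1 + ‖n‖ := by
        gcongr
        exact (norm_mul_le _ _).trans (mul_le_mul ((norm_mul_le _ _).trans (by gcongr; exact hnorm t))
          (hnorm _) (norm_nonneg _) (by positivity))
      _ = _ := by ring
  -- Let t → ∞ in ‖d‖ ≤ 2‖n‖/t.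
  have hd0 : d = 0 := by
    refine norm_le_zero_iff.1 (ge_of_tendsto ((tendsto_const_nhds (x := ‖n‖ + ‖n‖)).div_atTop
      Filter.tendsto_id) ?_)
    exact Filter.eventually_atTop.2 ⟨1, fun t ht => hb t (by positivity)⟩
  have := (smul_eq_zero.1 (hd ▸ hd0)).resolve_left Complex.I_ne_zero
  exact sub_eq_zero.1 this

end CommutatorLemma

/-! ### Complete positivity and multiplicative domains of dual maps -/

section Duality

variable {H K : Type*} [NormedAddCommGroup H] [InnerProductSpace ℂ H] [CompleteSpace H]
  [NormedAddCommGroup K] [InnerProductSpace ℂ K] [CompleteSpace K]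

theorem Operation.dual_eq_iff (Φ : Operation H K) (A : K →L[ℂ] K) (B : H →L[ℂ] H) :
    Φ.dual A = B ↔ ∀ T : TC H,
      trace (B * (T : H →L[ℂ] H)) = trace (A * (Φ.toLin T : K →L[ℂ] K)) := by
  refine ⟨?_, fun h => ext_trace_left fun T => by rw [h, Φ.dual_spec]⟩
  rintro rfl T
  exact Φ.dual_spec A T

theorem Operation.dual_add (Φ : Operation H K) (A B : K →L[ℂ] K) :
    Φ.dual (A + B) = Φ.dual A + Φ.dual B := by
  rw [Operation.dual_eq_iff]
  intro T
  have h1 := traceL_add (Φ.dual A) (Φ.dual B) T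
  have h2 := traceL_add A B (Φ.toLin T)
  simp only [traceL, LinearMap.coe_mk, AddHom.coe_mk] at h1 h2
  rw [h1, h2, Φ.dual_spec, Φ.dual_spec]

theorem Operation.dual_sub (Φ : Operation H K) (A B : K →L[ℂ] K) :
    Φ.dual (A - B) = Φ.dual A - Φ.dual B := by
  have h := Φ.dual_add (A - B) B
  rw [sub_add_cancel] at h
  rw [h, add_sub_cancel_right]

theorem Operation.IsChannel.dual_one {Φ : Operation H K} (h : Φ.IsChannel) : Φ.dual 1 = 1 := by
  rw [Operation.dual_eq_iff]
  intro T
  rw [one_mul, one_mul, h T]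

theorem Operation.inner_dual (Φ : Operation H K) (A : K →L[ℂ] K) (v w : H) :
    ⟪v, Φ.dual A w⟫_ℂ = traceL A (Φ.toLin (TC.ketbra w v)) := by
  rw [← traceL_ketbra]
  exact Φ.dual_spec A _

-- The form evaluates to |∑ᵢ ⟨vᵢ, wᵢ⟩|². These matrices are the test inputs through which complete
-- positivity passes to the dual.
omit [CompleteSpace H] in
theorem blockPositive_ketbra {n : ℕ} (v : Fin n → H) :
    BlockPositive (fun i j => (TC.ketbra (v i) (v j) : H →L[ℂ] H)) := by
  intro w
  have : ∑ i, ∑ j, ⟪w i, (TC.ketbra (v i) (v j) : H →L[ℂ] H) (w j)⟫_ℂ =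
      (starRingEnd ℂ) (∑ i, ⟪v i, w i⟫_ℂ) * ∑ j, ⟪v j, w j⟫_ℂ := by
    rw [map_sum, Finset.sum_mul_sum]
    refine Finset.sum_congr rfl fun i _ => Finset.sum_congr rfl fun j _ => ?_
    simp [TC.ketbra, mul_comm]
  rw [this, mul_comm, Complex.mul_conj]
  exact_mod_cast Complex.normSq_nonneg _

theorem mul_adjoint_mem_TC (B : H →L[ℂ] H) (S : TC H) : (S : H →L[ℂ] H) * B.adjoint ∈ TC H := by
  obtain ⟨f, g, hs, hT⟩ := S.2
  refine IsTraceClass.of_hasSum (f := f) (g := fun n => B (g n)) ?_ ?_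
  · refine (hs.mul_left ‖B‖).of_nonneg_of_le (fun n => by positivity) fun n => ?_
    rw [mul_left_comm]; gcongr; exact B.le_opNorm _
  · simpa [ContinuousLinearMap.mul_def, InnerProductSpace.rankOne_comp] using!
      hT.mul_right B.adjoint

/-- The dual of an operation is completely positive. -/
theorem Operation.sum_inner_dual_nonneg (Φ : Operation H K) {n : ℕ} (B : Fin n → (K →L[ℂ] K))
    (v : Fin n → H) : 0 ≤ ∑ i, ∑ j, ⟪v i, Φ.dual ((B i).adjoint * B j) (v j)⟫_ℂ := by
  obtain ⟨w, b, -⟩ := exists_hilbertBasis ℂ K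
  have hS := Φ.cp n _ (blockPositive_ketbra v)
  have h1 : ∀ i j, HasSum (fun k => ⟪(B j).adjoint (b k),
      (Φ.toLin (TC.ketbra (v j) (v i)) : K →L[ℂ] K) ((B i).adjoint (b k))⟫_ℂ)
      ⟪v i, Φ.dual ((B i).adjoint * B j) (v j)⟫_ℂ := fun i j => by
    set S := Φ.toLin (TC.ketbra (v j) (v i)) with hSd
    have h2 := hasSum_trace ⟨_, mul_adjoint_mem_TC (B i) (TC.lmul (B j) S)⟩ b
    have h3 : trace (((TC.lmul (B j) S : TC K) : K →L[ℂ] K) * (B i).adjoint) =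
        ⟪v i, Φ.dual ((B i).adjoint * B j) (v j)⟫_ℂ := by
      rw [trace_mul_comm, Φ.inner_dual, ← hSd]
      simp [traceL, TC.lmul, mul_assoc]
    rw [← h3]
    refine h2.congr_fun fun k => ?_
    simp [TC.lmul, ContinuousLinearMap.adjoint_inner_left]
  refine (hasSum_sum fun i _ => hasSum_sum fun j _ => h1 i j).nonneg fun k => ?_
  -- The (i, j) term carries |v j⟩⟨v i|, the transposed entry of the block matrix, so the two sums
  -- are exchanged before positivity is applied to the vectors (B i)* bₖ.
  rw [Finset.sum_comm]
  exact hS fun i => (B i).adjoint (b k)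

/-- Positivity for the pair (1, A) at the vectors (c x, y) forces the sum of all four terms to be
real. The diagonal terms are real already, so the cross terms sum to a real number for every scalar
c, and c = 1 and c = i together identify them as conjugates. -/
theorem Operation.dual_adjoint (Φ : Operation H K) (A : K →L[ℂ] K) :
    Φ.dual A.adjoint = (Φ.dual A).adjoint := by
  ext x
  refine ext_inner_left ℂ fun y => ?_
  have key : ∀ c : ℂ, (starRingEnd ℂ c * ⟪x, Φ.dual A y⟫_ℂ + c * ⟪y, Φ.dual A.adjoint x⟫_ℂ).im = 0 :=
    fun c => by
      have h0 := (Complex.le_def.1 (Φ.sum_inner_dual_nonneg ![1, A] ![c • x, y])).2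
      have h1 := (Complex.le_def.1 (Φ.sum_inner_dual_nonneg ![1] ![c • x])).2
      have h2 := (Complex.le_def.1 (Φ.sum_inner_dual_nonneg ![A] ![y])).2
      simp only [← ContinuousLinearMap.star_eq_adjoint] at h0 h1 h2 ⊢
      simp [Fin.sum_univ_two] at h0 h1 h2 ⊢
      linarith
  rw [ContinuousLinearMap.adjoint_inner_right, ← inner_conj_symm (Φ.dual A y) x]
  generalize ⟪x, Φ.dual A y⟫_ℂ = p at *
  generalize ⟪y, Φ.dual A.adjoint x⟫_ℂ = q at *
  have h1 := key 1
  have h2 := key Complex.I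
  simp at h1 h2
  apply Complex.ext
  · simp; linarith
  · simp; linarith

/-- Multiplicative domains: Choi's theorem for the dual of a channel. -/
theorem Operation.IsChannel.dual_mul_right {Φ : Operation H K} (h : Φ.IsChannel)
    {A : K →L[ℂ] K} (hA : Φ.dual (A.adjoint * A) = (Φ.dual A).adjoint * Φ.dual A)
    (C : K →L[ℂ] K) : Φ.dual (C * A) = Φ.dual C * Φ.dual A := by
  ext v
  refine ext_inner_left ℂ fun w => ?_
  set p := ⟪w, Φ.dual (C * A) v⟫_ℂ - ⟪w, Φ.dual C (Φ.dual A v)⟫_ℂ with hp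
  set r := ⟪w, Φ.dual (C * C.adjoint) w⟫_ℂ with hr
  have key : ∀ c : ℂ, 0 ≤ starRingEnd ℂ c * p + c * starRingEnd ℂ p + starRingEnd ℂ c * c * r :=
    fun c => by
      -- The vector -Φ*(A)v in the second slot makes the contributions of the first two slots
      -- cancel, by `hA` and unitality. What remains is a quadratic polynomial in c without constant
      -- term, whose linear part is governed by the defect p.
      have h0 := Φ.sum_inner_dual_nonneg ![A, 1, C.adjoint] ![v, - Φ.dual A v, c • w]
      have e1 : Φ.dual (A.adjoint * C.adjoint) = (Φ.dual (C * A)).adjoint := by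
        rw [← Φ.dual_adjoint, ContinuousLinearMap.mul_def, ContinuousLinearMap.mul_def,
          ContinuousLinearMap.adjoint_comp]
      have e2 : (1 : K →L[ℂ] K).adjoint = 1 := by
        rw [← ContinuousLinearMap.star_eq_adjoint, star_one]
      convert h0 using 1
      simp [Fin.sum_univ_three, e1, e2, hA, h.dual_one, Φ.dual_adjoint, inner_smul_left, hp, hr,
        ContinuousLinearMap.adjoint_inner_right, ContinuousLinearMap.adjoint_inner_left]
      ring
  have hr0 : 0 ≤ r := by
    have := Φ.sum_inner_dual_nonneg ![C.adjoint] ![w]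
    simpa using this
  obtain ⟨s, hs⟩ : ∃ s : ℝ, r = s := ⟨r.re, by
    have := (Complex.le_def.1 hr0).2
    apply Complex.ext <;> simp_all⟩
  have hs0 : 0 ≤ s := by rw [hs] at hr0; exact_mod_cast hr0
  -- Choosing c = tp makes the linear term real, equal to 2t|p|².
  have key2 : ∀ t : ℝ, 0 ≤ t * (2 * Complex.normSq p) + t * t * Complex.normSq p * s := fun t => by
    have := key (t * p)
    rw [hs] at this
    have e : starRingEnd ℂ (t * p) * p + t * p * starRingEnd ℂ p + starRingEnd ℂ (t * p) * (t * p) * s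
       = ((t * (2 * Complex.normSq p) + t * t * Complex.normSq p * s : ℝ) : ℂ) := by
      push_cast
      rw [← Complex.mul_conj]
      simp; ring
    rw [e] at this
    exact_mod_cast this
  have hp0 : p = 0 := by
    by_contra hne
    have hpos := Complex.normSq_pos.2 hne
    -- A negative t small enough that the linear term dominates: 2t + t²s = -(s + 2)/(s + 1)² < 0.
    have h1 := key2 (-(1 / (s + 1)))
    have h2 : -(1 / (s + 1)) * (2 * Complex.normSq p)
        + -(1 / (s + 1)) * -(1 / (s + 1)) * Complex.normSq p * s
        = - (Complex.normSq p * (s + 2) / (s + 1) ^ 2) := by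
      field_simp; ring
    rw [h2] at h1
    have : 0 < Complex.normSq p * (s + 2) / (s + 1) ^ 2 := by positivity
    linarith
  rw [mul_apply_eq_comp]
  exact sub_eq_zero.1 hp0

theorem Operation.IsChannel.dual_mul_left {Φ : Operation H K} (h : Φ.IsChannel)
    {A : K →L[ℂ] K} (hA : Φ.dual (A * A.adjoint) = Φ.dual A * (Φ.dual A).adjoint)
    (C : K →L[ℂ] K) : Φ.dual (A * C) = Φ.dual A * Φ.dual C := by
  have h1 := h.dual_mul_right (A := A.adjoint) (by
    simpa [Φ.dual_adjoint] using hA) C.adjoint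
  have h2 := congrArg ContinuousLinearMap.adjoint h1
  have e : C.adjoint * A.adjoint = (A * C).adjoint := by
    simp only [ContinuousLinearMap.mul_def, ContinuousLinearMap.adjoint_comp]
  rw [e] at h2
  rw [Φ.dual_adjoint, Φ.dual_adjoint, Φ.dual_adjoint, ContinuousLinearMap.adjoint_adjoint] at h2
  simpa [ContinuousLinearMap.mul_def, ContinuousLinearMap.adjoint_comp] using h2

end Duality

/-! ### Operators and traces on Hilbert space tensor products -/

section TensorOperators

variable {H K : Type*} [NormedAddCommGroup H] [InnerProductSpace ℂ H]
  [NormedAddCommGroup K] [InnerProductSpace ℂ K]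

theorem simpleTensor_add_left (x x' : H) (y : K) :
    simpleTensor (x + x') y = simpleTensor x y + simpleTensor x' y := by
  simp only [simpleTensor, TensorProduct.add_tmul]
  exact UniformSpace.Completion.coe_add _ _

theorem simpleTensor_add_right (x : H) (y y' : K) :
    simpleTensor x (y + y') = simpleTensor x y + simpleTensor x y' := by
  simp only [simpleTensor, TensorProduct.tmul_add]
  exact UniformSpace.Completion.coe_add _ _

theorem simpleTensor_smul_left (c : ℂ) (x : H) (y : K) :
    simpleTensor (c • x) y = c • simpleTensor x y := by
  simp only [simpleTensor, ← TensorProduct.smul_tmul']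
  exact UniformSpace.Completion.coe_smul c _

theorem opTensor_add_left (A A' : H →L[ℂ] H) (B : K →L[ℂ] K) :
    opTensor (A + A') B = opTensor A B + opTensor A' B :=
  ext_simpleTensor fun x y => by simp [opTensor_simpleTensor, simpleTensor_add_left]

theorem opTensor_add_right (A : H →L[ℂ] H) (B B' : K →L[ℂ] K) :
    opTensor A (B + B') = opTensor A B + opTensor A B' :=
  ext_simpleTensor fun x y => by simp [opTensor_simpleTensor, simpleTensor_add_right]

theorem opTensor_smul_left (c : ℂ) (A : H →L[ℂ] H) (B : K →L[ℂ] K) :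
    opTensor (c • A) B = c • opTensor A B :=
  ext_simpleTensor fun x y => by simp [opTensor_simpleTensor, simpleTensor_smul_left]

theorem opTensor_mul (A A' : H →L[ℂ] H) (B B' : K →L[ℂ] K) :
    opTensor A B * opTensor A' B' = opTensor (A * A') (B * B') :=
  ext_simpleTensor fun x y => by simp [opTensor_simpleTensor]

theorem norm_opTensor_le (A : H →L[ℂ] H) (B : K →L[ℂ] K) : ‖opTensor A B‖ ≤ ‖A‖ * ‖B‖ := by
  refine ContinuousLinearMap.opNorm_le_bound _ (by positivity) fun z => ?_
  induction z using UniformSpace.Completion.induction_on with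
  | hp => exact isClosed_le (by fun_prop) (by fun_prop)
  | ih a =>
    rw [opTensor, ContinuousLinearMap.completion_apply_coe, UniformSpace.Completion.norm_coe,
      UniformSpace.Completion.norm_coe]
    exact ((TensorProduct.mapL A B).le_opNorm a).trans
      (mul_le_mul_of_nonneg_right (TensorProduct.norm_mapL_le A B) (norm_nonneg a))

theorem adjoint_opTensor [CompleteSpace H] [CompleteSpace K] (A : H →L[ℂ] H) (B : K →L[ℂ] K) :
    (opTensor A B).adjoint = opTensor A.adjoint B.adjoint :=
  ext_simpleTensor fun x y => inner_ext_simpleTensor fun x' y' => by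
    simp only [ContinuousLinearMap.adjoint_inner_right, opTensor_simpleTensor, inner_simpleTensor]

/-- Nuclear expansions multiply, as matrix elements on simple tensors show. The explicit expansion
is kept so that the trace of S ⊗ T can be read off from it. -/
theorem hasSum_rankOne_opTensor {S : H →L[ℂ] H} {T : K →L[ℂ] K} {f g : ℕ → H} {f' g' : ℕ → K}
    (hs : Summable (fun n => ‖f n‖ * ‖g n‖)) (hS : HasSum (fun n => rankOne ℂ (f n) (g n)) S)
    (hs' : Summable (fun n => ‖f' n‖ * ‖g' n‖))
    (hT : HasSum (fun n => rankOne ℂ (f' n) (g' n)) T) :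
    Summable (fun p : ℕ × ℕ =>
      ‖simpleTensor (f p.1) (f' p.2)‖ * ‖simpleTensor (g p.1) (g' p.2)‖) ∧
    HasSum (fun p : ℕ × ℕ =>
      rankOne ℂ (simpleTensor (f p.1) (f' p.2)) (simpleTensor (g p.1) (g' p.2)))
      (opTensor S T) := by
  have hn : Summable (fun p : ℕ × ℕ =>
      ‖simpleTensor (f p.1) (f' p.2)‖ * ‖simpleTensor (g p.1) (g' p.2)‖) := by
    refine (hs.mul_of_nonneg hs' (fun n => by positivity) (fun n => by positivity)).congr
      fun p => ?_
    simp only [norm_simpleTensor]; ring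
  have hsum : Summable (fun p : ℕ × ℕ =>
      rankOne ℂ (simpleTensor (f p.1) (f' p.2)) (simpleTensor (g p.1) (g' p.2))) := by
    apply Summable.of_norm
    simpa using! hn
  refine ⟨hn, ?_⟩
  convert hsum.hasSum using 1
  refine ext_simpleTensor fun x y => inner_ext_simpleTensor fun x' y' => ?_
  have h1 : HasSum (fun n => ⟪x', f n⟫_ℂ * ⟪g n, x⟫_ℂ) ⟪x', S x⟫_ℂ := by
    have := (hS.mapL (ContinuousLinearMap.apply ℂ H x)).mapL (innerSL ℂ x')
    simpa [inner_smul_right, mul_comm] using this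
  have h2 : HasSum (fun n => ⟪y', f' n⟫_ℂ * ⟪g' n, y⟫_ℂ) ⟪y', T y⟫_ℂ := by
    have := (hT.mapL (ContinuousLinearMap.apply ℂ K y)).mapL (innerSL ℂ y')
    simpa [inner_smul_right, mul_comm] using this
  have h3 := (hsum.hasSum.mapL (ContinuousLinearMap.apply ℂ _ (simpleTensor x y))).mapL
    (innerSL ℂ (simpleTensor x' y'))
  rw [opTensor_simpleTensor, inner_simpleTensor]
  refine h1.mul_eq h2 (HasSum.congr_fun h3 fun p => ?_)
  simp [inner_simpleTensor]; ring

variable [CompleteSpace H] [CompleteSpace K]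

theorem trace_tensor (S : TC H) (T : TC K) :
    trace (TC.tensor S T : HTensor H K →L[ℂ] HTensor H K) =
      trace (S : H →L[ℂ] H) * trace (T : K →L[ℂ] K) := by
  obtain ⟨f, g, hs, hS⟩ := S.2
  obtain ⟨f', g', hs', hT⟩ := T.2
  obtain ⟨hn, hsum⟩ := hasSum_rankOne_opTensor hs hS hs' hT
  have h1 := hasSum_trace_mul hs hS 1
  have h2 := hasSum_trace_mul hs' hT 1
  have h3 := hasSum_trace_mul hn hsum 1
  simp only [one_mul, one_apply_eq_self, inner_simpleTensor] at h1 h2 h3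
  exact (h1.mul_eq h2 h3).symm

/-- `⟨v, (A ⊗ 1) w⟩` as a sum over the components of `v` and `w` for a basis of `K`. -/
theorem hasSum_inner_opTensor_one {ι : Type*} (b : HilbertBasis ι ℂ K) (A : H →L[ℂ] H)
    (v w : HTensor H K) :
    HasSum (fun i => ⟪(isHilbertSum_ampl (H := H) b).linearIsometryEquiv v i,
      A ((isHilbertSum_ampl (H := H) b).linearIsometryEquiv w i)⟫_ℂ) ⟪v, opTensor A 1 w⟫_ℂ := by
  have hV := isHilbertSum_ampl (H := H) b
  set U := hV.linearIsometryEquiv with hU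
  have e1 := hV.hasSum_linearIsometryEquiv_symm (U w)
  rw [← hU, U.symm_apply_apply] at e1
  have e2 := (e1.mapL (opTensor A (1 : K →L[ℂ] K))).mapL (innerSL ℂ v)
  refine HasSum.congr_fun e2 fun i => ?_
  classical
  have e3 : opTensor A (1 : K →L[ℂ] K) (ampl (b i) (b.orthonormal.1 i) (U w i)) =
      ampl (b i) (b.orthonormal.1 i) (A (U w i)) := opTensor_simpleTensor _ _ _ _
  have e4 : ampl (b i) (b.orthonormal.1 i) (A (U w i)) =
      U.symm (lp.single 2 i (A (U w i))) :=
    (hV.linearIsometryEquiv_symm_apply_single _).symm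
  rw [innerSL_apply_apply, e3, e4, ← U.inner_map_map, U.apply_symm_apply, lp.inner_single_right]

/-- Write B = C*C and absorb 1 ⊗ C into the vectors. What is left is the matrix T i j ⊗ 1, which
splits along a basis of K into copies of T. With B = ξ, this makes T ↦ T ⊗ ξ completely positive. -/
theorem BlockPositive.opTensor_right {n : ℕ} {T : Fin n → Fin n → (H →L[ℂ] H)}
    (hT : BlockPositive T) {B : K →L[ℂ] K} (hB : B.IsPositive) :
    BlockPositive (fun i j => opTensor (T i j) B) := by
  intro v
  obtain ⟨w, b, -⟩ := exists_hilbertBasis ℂ K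
  obtain ⟨C, hC⟩ := CStarAlgebra.nonneg_iff_eq_star_mul_self.1
    ((ContinuousLinearMap.nonneg_iff_isPositive B).2 hB)
  have h1 : ∀ i j, ⟪v i, opTensor (T i j) B (v j)⟫_ℂ =
      ⟪opTensor 1 C (v i), opTensor (T i j) 1 (opTensor 1 C (v j))⟫_ℂ := fun i j => by
    have e : opTensor (T i j) B = (opTensor 1 C).adjoint * (opTensor (T i j) 1 * opTensor 1 C) := by
      rw [adjoint_opTensor, opTensor_mul, opTensor_mul, hC,
        ContinuousLinearMap.star_eq_adjoint, ← ContinuousLinearMap.star_eq_adjoint 1, star_one,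
        one_mul, one_mul, mul_one]
    rw [e, mul_apply_eq_comp, mul_apply_eq_comp, ContinuousLinearMap.adjoint_inner_right]
  simp only [h1]
  refine (hasSum_sum fun i _ => hasSum_sum fun j _ =>
    hasSum_inner_opTensor_one b (T i j) _ _).nonneg fun k => ?_
  exact hT _

end TensorOperators

/-! ### Weak continuity of A ⊗ B in B, and sums over pointer outcomes -/

section Normality

variable {H K X : Type*} [NormedAddCommGroup H] [InnerProductSpace ℂ H]
  [NormedAddCommGroup K] [InnerProductSpace ℂ K]

/-- A uniform norm bound makes the functionals equicontinuous, so convergence only has to be tested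
on a dense set. -/
theorem isClosed_setOf_tendsto_apply {V ι : Type*} [NormedAddCommGroup V] [NormedSpace ℂ V]
    {l : Filter ι} (F : ι → V →L[ℂ] ℂ) (F₀ : V →L[ℂ] ℂ) {C : ℝ} (hF : ∀ s, ‖F s‖ ≤ C) :
    IsClosed {v | Filter.Tendsto (fun s => F s v) l (nhds (F₀ v))} := by
  refine Equicontinuous.isClosed_setOfPred_tendsto ?_ F₀.continuous
  refine (LipschitzWith.uniformEquicontinuous (fun s => ⇑(F s)) C.toNNReal
    fun s => ?_).equicontinuous
  exact (F s).lipschitz.weaken (by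
    rw [← norm_toNNReal]; exact Real.toNNReal_le_toNNReal (hF s))

theorem tendsto_apply_of_simpleTensor {ι : Type*} {l : Filter ι} (F : ι → HTensor H K →L[ℂ] ℂ)
    (F₀ : HTensor H K →L[ℂ] ℂ) {C : ℝ} (hF : ∀ s, ‖F s‖ ≤ C)
    (h : ∀ x y, Filter.Tendsto (fun s => F s (simpleTensor x y)) l
      (nhds (F₀ (simpleTensor x y)))) (v : HTensor H K) :
    Filter.Tendsto (fun s => F s v) l (nhds (F₀ v)) := by
  have hcl := isClosed_setOf_tendsto_apply (l := l) F F₀ hF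
  refine closure_minimal (fun z hz => ?_) hcl (dense_simpleTensor v)
  induction hz using Submodule.span_induction with
  | mem z hz =>
    obtain ⟨x, y, rfl⟩ := hz
    exact h x y
  | zero => simpa using tendsto_const_nhds
  | add z z' _ _ hz hz' => simpa using Filter.Tendsto.add hz hz'
  | smul c z _ hz => simpa using Filter.Tendsto.const_mul c hz

theorem tendsto_inner_opTensor {ι : Type*} {l : Filter ι} {P : ι → K →L[ℂ] K} {Q : K →L[ℂ] K}
    {C : ℝ} (hC : ∀ s, ‖P s‖ ≤ C)
    (hP : ∀ φ ψ, Filter.Tendsto (fun s => ⟪φ, P s ψ⟫_ℂ) l (nhds ⟪φ, Q ψ⟫_ℂ))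
    (A : H →L[ℂ] H) (v w : HTensor H K) :
    Filter.Tendsto (fun s => ⟪v, opTensor A (P s) w⟫_ℂ) l (nhds ⟪v, opTensor A Q w⟫_ℂ) := by
  have hb : ∀ s, ‖opTensor A (P s)‖ ≤ ‖A‖ * C := fun s =>
    (norm_opTensor_le _ _).trans (by gcongr; exact hC s)
  have h1 : ∀ x y (w : HTensor H K), Filter.Tendsto
      (fun s => ⟪simpleTensor x y, opTensor A (P s) w⟫_ℂ) l
      (nhds ⟪simpleTensor x y, opTensor A Q w⟫_ℂ) := fun x y w => by
    refine tendsto_apply_of_simpleTensor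
      (fun s => (innerSL ℂ (simpleTensor x y)).comp (opTensor A (P s)))
      ((innerSL ℂ (simpleTensor x y)).comp (opTensor A Q))
      (C := ‖simpleTensor x y‖ * (‖A‖ * C)) (fun s => ?_) (fun x' y' => ?_) w
    · refine (ContinuousLinearMap.opNorm_comp_le _ _).trans ?_
      rw [innerSL_apply_norm]
      gcongr
      exact hb s
    · simpa [opTensor_simpleTensor, inner_simpleTensor] using (hP y y').const_mul _
  -- The inner product is conjugate linear in its left argument. Conjugation moves v to the linear
  -- side, so the density argument can be used a second time.
  have h2 : Filter.Tendsto (fun s => ⟪opTensor A (P s) w, v⟫_ℂ) l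
      (nhds ⟪opTensor A Q w, v⟫_ℂ) := by
    refine tendsto_apply_of_simpleTensor (fun s => innerSL ℂ (opTensor A (P s) w))
      (innerSL ℂ (opTensor A Q w)) (C := ‖A‖ * C * ‖w‖) (fun s => ?_) (fun x y => ?_) v
    · rw [innerSL_apply_norm]
      exact ((opTensor A (P s)).le_opNorm w).trans (by gcongr; exact hb s)
    · have := (Complex.continuous_conj.tendsto _).comp (h1 x y w)
      simpa [Function.comp_def] using this
  have := (Complex.continuous_conj.tendsto _).comp h2
  simpa [Function.comp_def] using this

variable [CompleteSpace H] [CompleteSpace K]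

theorem Observable.norm_sum_effect_le (Z : Observable X K) (s : Finset X) :
    ‖∑ x ∈ s, Z.effect x‖ ≤ 1 := by
  have h0 : 0 ≤ ∑ x ∈ s, Z.effect x := Finset.sum_nonneg fun x _ =>
    (ContinuousLinearMap.nonneg_iff_isPositive _).2 (Z.pos x)
  rw [CStarAlgebra.norm_le_one_iff_of_nonneg _ h0, ← sub_nonneg,
    ContinuousLinearMap.nonneg_iff_isPositive]
  refine isPositive_of_inner_nonneg fun φ => ?_
  have h1 := sum_le_hasSum s (fun x _ => (Z.pos x).inner_nonneg_right φ) (Z.hasSum_one φ φ)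
  simpa [inner_sub_right, inner_sum, sum_apply] using h1

-- Finite sums of pointer effects have norm at most 1 and tend weakly to 1. In a nuclear expansion
-- of S the terms are dominated by ‖A‖ ‖fₙ‖ ‖gₙ‖, so dominated convergence moves the limit through
-- the trace.
omit [CompleteSpace H] in
theorem Observable.hasSum_trace_opTensor (Z : Observable X K) (A : H →L[ℂ] H)
    (S : TC (HTensor H K)) :
    HasSum (fun x => trace (opTensor A (Z.effect x) * (S : HTensor H K →L[ℂ] HTensor H K)))
      (trace (opTensor A 1 * (S : HTensor H K →L[ℂ] HTensor H K))) := by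
  obtain ⟨f, g, hs, hS⟩ := S.2
  have h1 : ∀ s : Finset X,
      ∑ x ∈ s, trace (opTensor A (Z.effect x) * (S : HTensor H K →L[ℂ] HTensor H K)) =
      ∑' n, ⟪g n, opTensor A (∑ x ∈ s, Z.effect x) (f n)⟫_ℂ := fun s => by
    rw [(hasSum_trace_mul hs hS _).tsum_eq]
    classical
    induction s using Finset.induction_on with
    | empty =>
      have : opTensor A (0 : K →L[ℂ] K) = 0 :=
        ext_simpleTensor fun x y => by
          rw [opTensor_simpleTensor]; simp [simpleTensor]
      simp [this, trace]
    | insert x s hx ih =>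
      rw [Finset.sum_insert hx, Finset.sum_insert hx, ih, opTensor_add_right]
      exact (traceL_add _ _ S).symm
  rw [HasSum, SummationFilter.unconditional_filter, ← (hasSum_trace_mul hs hS _).tsum_eq]
  simp only [h1]
  refine tendsto_tsum_of_dominated_convergence (hs.mul_left ‖A‖) (fun n => ?_)
    (Filter.Eventually.of_forall fun s n => ?_)
  · refine tendsto_inner_opTensor (C := 1) Z.norm_sum_effect_le (fun φ ψ => ?_) A _ _
    have := Z.hasSum_one φ ψ
    rw [HasSum, SummationFilter.unconditional_filter] at this
    simpa [inner_sum, sum_apply] using this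
  · refine (norm_inner_le_norm _ _).trans ?_
    have h2 := (opTensor A (∑ x ∈ s, Z.effect x)).le_opNorm (f n)
    have h3 : ‖opTensor A (∑ x ∈ s, Z.effect x)‖ ≤ ‖A‖ := (norm_opTensor_le _ _).trans
      (mul_le_of_le_one_right (norm_nonneg _) (Z.norm_sum_effect_le s))
    calc _ ≤ ‖g n‖ * (‖A‖ * ‖f n‖) := by gcongr; exact h2.trans (by gcongr)
      _ = _ := by ring

end Normality

/-! ### Pure states separate bounded operators -/

section States

variable {H : Type*} [NormedAddCommGroup H] [InnerProductSpace ℂ H] [CompleteSpace H]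

/-- The pure state of a unit vector. -/
def State.pure (x : H) (hx : ‖x‖ = 1) : State H where
  op := TC.ketbra x x
  pos := isPositive_rankOne_self x
  trace_eq_one := by
    rw [← traceL_one, traceL_ketbra]
    simp [inner_self_eq_norm_sq_to_K, hx]

omit [CompleteSpace H] in
theorem ext_inner_self_of_unit {A B : H →L[ℂ] H}
    (h : ∀ x, ‖x‖ = 1 → ⟪x, A x⟫_ℂ = ⟪x, B x⟫_ℂ) : A = B := by
  rw [← sub_eq_zero, ← ContinuousLinearMap.coe_inj]
  refine (inner_map_self_eq_zero _).1 fun x => ?_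
  rcases eq_or_ne x 0 with rfl | hx
  · simp
  have h1 := h ((‖x‖⁻¹ : ℂ) • x) (by
    rw [norm_smul, norm_inv, Complex.norm_real, norm_norm, inv_mul_cancel₀ (norm_ne_zero_iff.2 hx)])
  have hx' : (‖x‖ : ℂ) ≠ 0 := by exact_mod_cast norm_ne_zero_iff.2 hx
  rw [map_smul, map_smul, inner_smul_left, inner_smul_left, inner_smul_right, inner_smul_right]
    at h1
  have h2 := mul_left_cancel₀ (inv_ne_zero hx') (mul_left_cancel₀
    (by simpa using hx) h1)
  rw [← inner_conj_symm]
  simp only [ContinuousLinearMap.coe_coe, sub_apply, inner_sub_right, h2, sub_self]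
  simp

/-- A bounded operator is determined by its expectation values in states. -/
theorem ext_trace_state {A B : H →L[ℂ] H} (h : ∀ ρ : State H,
    trace (A * (ρ.op : H →L[ℂ] H)) = trace (B * (ρ.op : H →L[ℂ] H))) : A = B := by
  refine ext_inner_self_of_unit fun x hx => ?_
  rw [← traceL_ketbra, ← traceL_ketbra]
  exact h (State.pure x hx)

end States

/-! ### The channel of a measurement scheme and its dual -/

section Schemes

variable {H K X Y : Type*} [NormedAddCommGroup H] [InnerProductSpace ℂ H] [CompleteSpace H]
  [NormedAddCommGroup K] [InnerProductSpace ℂ K] [CompleteSpace K]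

/-- The channel `T ↦ ℰ(T ⊗ ξ)` from the system to system and apparatus. -/
def MeasurementScheme.channel (M : MeasurementScheme X H K) : Operation H (HTensor H K) where
  toLin :=
    { toFun := fun T => M.interaction.toLin (TC.tensor T M.state.op)
      map_add' := fun S T => by
        rw [← map_add]
        congr 1
        exact Subtype.ext (opTensor_add_left _ _ _)
      map_smul' := fun c T => by
        rw [RingHom.id_apply, ← map_smul]
        congr 1
        exact Subtype.ext (opTensor_smul_left _ _ _) }
  cp := fun n T hT => M.interaction.cp n (fun i j => TC.tensor (T i j) M.state.op)
    (BlockPositive.opTensor_right hT M.state.pos)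
  trace_le := fun T _ => by
    change trace (M.interaction.toLin _ : HTensor H K →L[ℂ] HTensor H K) ≤ _
    rw [M.isChannel_interaction, trace_tensor, M.state.trace_eq_one, mul_one]

theorem MeasurementScheme.channel_toLin (M : MeasurementScheme X H K) (T : TC H) :
    M.channel.toLin T = M.interaction.toLin (TC.tensor T M.state.op) := rfl

theorem MeasurementScheme.isChannel_channel (M : MeasurementScheme X H K) :
    M.channel.IsChannel := fun T => by
  rw [M.channel_toLin, M.isChannel_interaction, trace_tensor, M.state.trace_eq_one, mul_one]

theorem MeasurementScheme.Implements.trace_mul {M : MeasurementScheme X H K} {I : Instrument X H}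
    (h : M.Implements I) (x : X) (A : H →L[ℂ] H) (T : TC H) :
    trace (A * ((I.op x).toLin T : H →L[ℂ] H)) =
      trace (opTensor A (M.pointer.effect x) *
        (M.channel.toLin T : HTensor H K →L[ℂ] HTensor H K)) := by
  rw [h x T, partialTrace_spec, M.channel_toLin, TC.lmul, ← mul_assoc, opTensor_mul, mul_one,
    one_mul]

theorem MeasurementScheme.Implements.dual_channel {M : MeasurementScheme X H K}
    {I : Instrument X H} (h : M.Implements I) (x : X) (A : H →L[ℂ] H) :
    M.channel.dual (opTensor A (M.pointer.effect x)) = (I.op x).dual A := by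
  rw [Operation.dual_eq_iff]
  intro T
  rw [Operation.dual_spec, h.trace_mul]

/-- Both sides are the sum over x of tr[A I_x(T)]: one by definition of the total channel, the other
because the pointer effects sum to 1. -/
theorem MeasurementScheme.Implements.dual_channel_one {M : MeasurementScheme X H K}
    {I : Instrument X H} (h : M.Implements I) (A : H →L[ℂ] H) :
    M.channel.dual (opTensor A 1) = I.total.dual A := by
  rw [Operation.dual_eq_iff]
  intro T
  rw [Operation.dual_spec]
  refine (I.hasSum_total T A).unique ?_
  simp only [h.trace_mul]
  exact M.pointer.hasSum_trace_opTensor A _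

/-- If the interaction conserves `N_S ⊗ 1 + 1 ⊗ N_A` on average, the Heisenberg evolution of this
quantity, averaged over the apparatus state `ξ`, is `N_S + tr[N_A ξ]`. -/
theorem MeasurementScheme.dual_channel_additive (M : MeasurementScheme X H K)
    {NS : H →L[ℂ] H} {NA : K →L[ℂ] K} (hN : M.interaction.ConservesOnAverage (additive NS NA)) :
    M.channel.dual (additive NS NA) = NS + trace (NA * (M.state.op : K →L[ℂ] K)) • 1 := by
  set c := trace (NA * (M.state.op : K →L[ℂ] K)) with hc
  refine ext_inner_self_of_unit fun x hx => ?_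
  have ht : trace (TC.ketbra x x : H →L[ℂ] H) = 1 := (State.pure x hx).trace_eq_one
  have hpos : (TC.tensor (TC.ketbra x x) M.state.op :
      HTensor H K →L[ℂ] HTensor H K).IsPositive := by
    refine isPositive_of_inner_nonneg fun v => ?_
    have h1 : BlockPositive (fun _ _ : Fin 1 => (TC.ketbra x x : H →L[ℂ] H)) :=
      blockPositive_ketbra fun _ => x
    simpa using! h1.opTensor_right M.state.pos fun _ => v
  -- Conservation is needed only at the product states |x⟩⟨x| ⊗ ξ, where the expectation of N splits
  -- into ⟨x, N_S x⟩ and tr[N_A ξ].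
  have h1 := hN ⟨TC.tensor (TC.ketbra x x) M.state.op, hpos, by
    rw [trace_tensor, ht, M.state.trace_eq_one, mul_one]⟩
  have h2 : trace (additive NS NA * (TC.tensor (TC.ketbra x x) M.state.op :
      HTensor H K →L[ℂ] HTensor H K)) = ⟪x, NS x⟫_ℂ + c := by
    have e1 := trace_tensor (TC.lmul NS (TC.ketbra x x)) M.state.op
    have e2 := trace_tensor (TC.ketbra x x) (TC.lmul NA M.state.op)
    have e3 : trace (NS * (TC.ketbra x x : H →L[ℂ] H)) = ⟪x, NS x⟫_ℂ := traceL_ketbra NS x x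
    have e4 := traceL_add (opTensor NS 1) (opTensor 1 NA) (TC.tensor (TC.ketbra x x) M.state.op)
    rw [M.state.trace_eq_one, mul_one] at e1
    rw [ht, one_mul] at e2
    rw [hc, ← e3]
    refine e4.trans ?_
    simp only [traceL, LinearMap.coe_mk, AddHom.coe_mk, TC.tensor, opTensor_mul, one_mul]
    exact congrArg₂ (· + ·) e1 e2
  rw [Operation.inner_dual, M.channel_toLin]
  refine h1.trans (h2.trans ?_)
  simp [inner_self_eq_norm_sq_to_K, hx]

/-! ### Fixed points and the operators they commute with -/

/-- Elements of a von Neumann algebra of fixed points, amplified to the compound system, are in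
the multiplicative domain of the dual channel. -/
theorem MeasurementScheme.Implements.dual_channel_mul {M : MeasurementScheme X H K}
    {I : Instrument X H} (h : M.Implements I) {V : VonNeumannAlgebra H}
    (hV : (V : Set (H →L[ℂ] H)) = I.total.fixedPoints) {A : H →L[ℂ] H}
    (hA : A ∈ I.total.fixedPoints) (C : HTensor H K →L[ℂ] HTensor H K) :
    M.channel.dual (C * opTensor A 1) = M.channel.dual C * A ∧
      M.channel.dual (opTensor A 1 * C) = A * M.channel.dual C := by
  have hAV : A ∈ V := by rw [← SetLike.mem_coe, hV]; exact hA
  have hfix : ∀ B ∈ V, I.total.dual B = B := fun B hB => by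
    rw [← SetLike.mem_coe, hV] at hB; exact hB
  have h1 : M.channel.dual (opTensor A 1) = A := by rw [h.dual_channel_one, hfix A hAV]
  have hs : (opTensor A (1 : K →L[ℂ] K)).adjoint = opTensor (star A) 1 := by
    rw [adjoint_opTensor, ← ContinuousLinearMap.star_eq_adjoint,
      ← ContinuousLinearMap.star_eq_adjoint, star_one]
  constructor
  · have := M.isChannel_channel.dual_mul_right (A := opTensor A 1) (by
      rw [hs, opTensor_mul, one_mul, h.dual_channel_one, h1,
        hfix _ (mul_mem (star_mem hAV) hAV), ContinuousLinearMap.star_eq_adjoint]) C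
    rwa [h1] at this
  · have := M.isChannel_channel.dual_mul_left (A := opTensor A 1) (by
      rw [hs, opTensor_mul, one_mul, h.dual_channel_one, h1,
        hfix _ (mul_mem hAV (star_mem hAV)), ContinuousLinearMap.star_eq_adjoint]) C
    rwa [h1] at this

/-- The two products of A ⊗ 1 with 1 ⊗ B agree, and the bimodule property evaluates the dual channel
on them as A Γ(1 ⊗ B) and Γ(1 ⊗ B) A. -/
theorem MeasurementScheme.Implements.commute_dual_channel {M : MeasurementScheme X H K}
    {I : Instrument X H} (h : M.Implements I) {V : VonNeumannAlgebra H}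
    (hV : (V : Set (H →L[ℂ] H)) = I.total.fixedPoints) {A : H →L[ℂ] H}
    (hA : A ∈ I.total.fixedPoints) (B : K →L[ℂ] K) :
    Commute A (M.channel.dual (opTensor 1 B)) := by
  have h1 := h.dual_channel_mul hV hA (opTensor 1 B)
  rw [opTensor_mul, opTensor_mul] at h1
  simp only [one_mul, mul_one] at h1
  exact h1.2.symm.trans h1.1

theorem MeasurementScheme.Implements.dual_channel_pointer {M : MeasurementScheme X H K}
    {I : Instrument X H} (h : M.Implements I) {E : Observable X H} (hE : I.IsCompatible E)
    (x : X) : M.channel.dual (opTensor 1 (M.pointer.effect x)) = E.effect x := by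
  rw [h.dual_channel, hE x]

theorem MeasurementScheme.Implements.commute_effect {M : MeasurementScheme X H K}
    {I : Instrument X H} (h : M.Implements I) {E : Observable X H} (hE : I.IsCompatible E)
    {V : VonNeumannAlgebra H} (hV : (V : Set (H →L[ℂ] H)) = I.total.fixedPoints) {A : H →L[ℂ] H}
    (hA : A ∈ I.total.fixedPoints) (x : X) : Commute A (E.effect x) := by
  rw [← h.dual_channel_pointer hE]
  exact h.commute_dual_channel hV hA _

/-- By conservation, the change of N_S is a scalar minus the dual channel's value at 1 ⊗ N_A. -/
theorem MeasurementScheme.Implements.commute_change {M : MeasurementScheme X H K}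
    {I : Instrument X H} (h : M.Implements I) {V : VonNeumannAlgebra H}
    (hV : (V : Set (H →L[ℂ] H)) = I.total.fixedPoints) {NS : H →L[ℂ] H} {NA : K →L[ℂ] K}
    (hN : M.interaction.ConservesOnAverage (additive NS NA)) {A : H →L[ℂ] H}
    (hA : A ∈ I.total.fixedPoints) : Commute A (I.total.dual NS - NS) := by
  have h1 := M.dual_channel_additive hN
  rw [additive, Operation.dual_add, h.dual_channel_one] at h1
  have h2 : I.total.dual NS - NS = trace (NA * (M.state.op : K →L[ℂ] K)) • 1
      - M.channel.dual (opTensor 1 NA) := by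
    rw [eq_sub_of_add_eq h1]; abel
  rw [h2]
  exact ((Commute.one_right A).smul_right _).sub_right (h.commute_dual_channel hV hA NA)

theorem MeasurementScheme.Implements.commute_conserved {M : MeasurementScheme X H K}
    {I : Instrument X H} (h : M.Implements I) {E : Observable X H} (hE : I.IsCompatible E)
    {V : VonNeumannAlgebra H} (hV : (V : Set (H →L[ℂ] H)) = I.total.fixedPoints)
    {NS : H →L[ℂ] H} {NA : K →L[ℂ] K}
    (hN : M.interaction.ConservesOnAverage (additive NS NA)) (hI : I.IsFirstKind E) :
    E.CommutesWith NS := by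
  intro x
  have hx : E.effect x ∈ I.total.fixedPoints := hI x
  refine commute_of_commute_commutator (E.pos x).isSelfAdjoint ?_
  -- Once the commutator is a fixed point, it commutes with E(x) like every other fixed point, as
  -- the commutator lemma requires.
  suffices hfix : E.effect x * NS - NS * E.effect x ∈ I.total.fixedPoints from
    (h.commute_effect hE hV hfix x).symm
  have h1 := h.dual_channel_mul hV hx (opTensor NS 1)
  rw [opTensor_mul, opTensor_mul, one_mul, h.dual_channel_one, h.dual_channel_one,
    h.dual_channel_one] at h1
  -- Replacing I_X*(N_S) by N_S inside the commutator with E(x) costs only [E(x), ΔN_S] = 0.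
  have h2 := (h.commute_change hV hN hx).eq
  rw [mul_sub, sub_mul] at h2
  change I.total.dual _ = _
  rw [Operation.dual_sub, h1.1, h1.2]
  rw [sub_eq_sub_iff_add_eq_add] at h2 ⊢
  rw [h2]; abel

/-! ### Repeatable instruments -/

theorem Instrument.IsCompatible.trace_op {I : Instrument X H} {E : Observable X H}
    (hE : I.IsCompatible E) (x : X) (T : TC H) :
    trace ((I.op x).toLin T : H →L[ℂ] H) = trace (E.effect x * (T : H →L[ℂ] H)) := by
  rw [← hE x, Operation.dual_spec, one_mul]

theorem Instrument.IsRepeatable.dual_effect_self {I : Instrument X H} {E : Observable X H}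
    (hI : I.IsRepeatable) (hE : I.IsCompatible E) (x : X) :
    (I.op x).dual (E.effect x) = E.effect x :=
  ext_trace_state fun ρ => by
    rw [Operation.dual_spec, ← hE.trace_op, ← hE.trace_op, (hI ρ).1]

theorem Instrument.IsRepeatable.dual_effect_of_ne {I : Instrument X H} {E : Observable X H}
    (hI : I.IsRepeatable) (hE : I.IsCompatible E) {x y : X} (hxy : x ≠ y) :
    (I.op x).dual (E.effect y) = 0 :=
  ext_trace_state fun ρ => by
    rw [Operation.dual_spec, ← hE.trace_op, (hI ρ).2 x y hxy]
    simp [trace]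

/-- In the sum of I_x*(E(y)) over x only x = y survives, and it contributes E(y). -/
theorem Instrument.IsRepeatable.isFirstKind {I : Instrument X H} {E : Observable X H}
    (hI : I.IsRepeatable) (hE : I.IsCompatible E) : I.IsFirstKind E := by
  intro y
  rw [Operation.dual_eq_iff]
  intro T
  have h1 := hasSum_single (f := fun x => trace (E.effect y * ((I.op x).toLin T : H →L[ℂ] H))) y
    fun x hx => by
      rw [← Operation.dual_spec, hI.dual_effect_of_ne hE hx]
      simp [trace]
  refine HasSum.unique ?_ (I.hasSum_total T (E.effect y))
  convert h1 using 1
  rw [← Operation.dual_spec, hI.dual_effect_self hE]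

theorem MeasurementScheme.Implements.isSharp {M : MeasurementScheme X H K}
    {I : Instrument X H} (h : M.Implements I) {E : Observable X H} (hE : I.IsCompatible E)
    {V : VonNeumannAlgebra H} (hV : (V : Set (H →L[ℂ] H)) = I.total.fixedPoints)
    (hI : I.IsRepeatable) : E.IsSharp := by
  -- E(x) is a fixed point and E(y) = Γ(1 ⊗ Z(y)), so the bimodule property gives E(x)E(y) = Γ(E(x)
  -- ⊗ Z(y)).
  have key : ∀ x y, E.effect x * E.effect y = (I.op y).dual (E.effect x) := fun x y => by
    have h1 := (h.dual_channel_mul hV (hI.isFirstKind hE x)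
      (opTensor 1 (M.pointer.effect y))).2
    rwa [opTensor_mul, mul_one, one_mul, h.dual_channel, h.dual_channel_pointer hE, eq_comm] at h1
  exact ⟨fun x => by rw [key, hI.dual_effect_self hE],
    fun x y hxy => by rw [key, hI.dual_effect_of_ne hE hxy.symm]⟩

end Schemes

end

end QMeas

theorem mainTheorem7
    {HS HA X : Type*}
    [NormedAddCommGroup HS] [InnerProductSpace ℂ HS] [CompleteSpace HS]
    [TopologicalSpace.SeparableSpace HS]
    [NormedAddCommGroup HA] [InnerProductSpace ℂ HA] [CompleteSpace HA]
    [TopologicalSpace.SeparableSpace HA]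
    [Countable X]
    (E : QMeas.Observable X HS) (I : QMeas.Instrument X HS) (hIE : I.IsCompatible E)
    (M : QMeas.MeasurementScheme X HS HA) (hMI : M.Implements I)
    (NS : HS →L[ℂ] HS) (hNS : IsSelfAdjoint NS) (NA : HA →L[ℂ] HA) (hNA : IsSelfAdjoint NA)
    (hN : M.interaction.ConservesOnAverage (QMeas.additive NS NA))
    (hF : ∃ V : VonNeumannAlgebra HS, (V : Set (HS →L[ℂ] HS)) = I.total.fixedPoints) :
    (∀ {Y : Type*} [Countable Y] (F : QMeas.Observable Y HS), I.NotDisturbs F →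
      F.CommutesWithObs E ∧ F.CommutesWith (I.total.dual NS - NS) ∧
        (F.CommutesWith NS → F.CommutesWith (I.total.dual NS - NS))) ∧
    (I.IsFirstKind E → E.IsCommutative ∧ E.CommutesWith NS) ∧
    (I.IsRepeatable → E.IsSharp ∧ E.CommutesWith NS) := by
  obtain ⟨V, hV⟩ := hF
  refine ⟨fun F hIF => ?_, fun hI => ?_, fun hI => ?_⟩
  · have h1 : F.CommutesWith (I.total.dual NS - NS) := fun y => hMI.commute_change hV hN (hIF y)
    exact ⟨fun y x => hMI.commute_effect hIE hV (hIF y) x, h1, fun _ => h1⟩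
  · exact ⟨fun x y => hMI.commute_effect hIE hV (hI x) y, hMI.commute_conserved hIE hV hN hI⟩
  · exact ⟨hMI.isSharp hIE hV hI, hMI.commute_conserved hIE hV hN (hI.isFirstKind hIE)⟩
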